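/- **Theorem.** Let $\mathbb H^d$ be the space of quaternionic column vectors with its Euclidean metric and flat hyperkähler structure, and let $Sp(d)=\{A\in \mathrm{Mat}_d(\mathbb H): A^\dagger A=AA^\dagger=1\}$ ($\dagger$ is the quaternionic conjugate transpose) act on it by left multiplication. Let $G$ be a closed subgroup of $Sp(d)$ with Lie algebra $\mathfrak g=\{A\in \mathrm{Mat}_d(\mathbb H) : \exp(tA)\in G \text{ for all } t\in\mathbb R\}$, and let $\mu=(\mu_1,\mu_2,\mu_3):\mathbb H^d\to\mathfrak g\otimes\mathbb R^3$ be the hyperkähler moment map whose components are the orthogonal projections, with respect to $\langle A,B\rangle=\mathrm{Re}\,\mathrm{tr}(AB^\dagger)$, of $$q\,i\,q^\dagger,\qquad q\,j\,q^\dagger,\qquad q\,k\,q^\dagger$$ onto $\mathfrak g$. Suppose that $G$ acts locally freely on $\mu^{-1}(0)\setminus\{0\}$, i.e. the stabilizer of every point of this set is discrete. Let $c=(c_1,c_2,c_3)$, where each $c_l$ is a central element of $\mathfrak g$, and suppose that $G$ acts freely on $\mu^{-1}(c)$ (that is, $G$ preserves $\mu^{-1}(c)$ and all stabilizers of its points are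 trivial). Then the hyperkähler quotient $Q=\mu^{-1}(c)/G$ (with the quotient topology) is covered by smooth charts of dimension $n=4d-4\dim G$: every point of $Q$ lies in the image of a chart given by a smooth local slice $s:U\to\mu^{-1}(c)$, where $U\subseteq\mathbb R^{n}$ is open, $s$ is transverse to the $G$-orbits, and $s$ induces a homeomorphism of $U$ onto an open subset of $Q$. Let $Q$ carry the quotient metric, for which $\mu^{-1}(c)\to Q$ is a Riemannian submersion, $\mu^{-1}(c)$ having the metric induced from $\mathbb H^d$; in a chart $s$ it is $g_{ab}=\langle(\partial_a s)^h,(\partial_b s)^h\rangle$, where $h$ denotes the component orthogonal to the orbit. Then the curvature of $Q$ is asymptotically null: for every $\varepsilon>0$ there is a compact set $C\subseteq Q$ such that the sectional curvatures of $Q$ satisfy $|K_Q(p)(\pi)|<\varepsilon$ for every $p\in Q\setminus C$ and every plane $\pi\subset T_pQ$. -/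

import Mathlib

open scoped Quaternion Matrix Topology ContDiff
open Filter

noncomputable section

namespace HKQuot

/-! ## The Lie product formula (needed for the Lie algebra of a closed matrix group) -/

section LieProduct

variable {𝔸 : Type*} [NormedRing 𝔸] [NormedAlgebra ℝ 𝔸] [CompleteSpace 𝔸]

theorem tendsto_pow_exp_of_hasDerivAt {γ : ℝ → 𝔸} {X : 𝔸} (h0 : γ 0 = 1)
    (hγ : HasDerivAt γ X 0) :
    Tendsto (fun n : ℕ => γ ((n : ℝ)⁻¹) ^ n) atTop (𝓝 (NormedSpace.exp X)) := by
  let _ : NormedAlgebra ℚ 𝔸 := NormedAlgebra.restrictScalars ℚ ℝ 𝔸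
  have hexp : HasStrictFDerivAt (NormedSpace.exp : 𝔸 → 𝔸)
      ((ContinuousLinearEquiv.refl ℝ 𝔸 : 𝔸 ≃L[ℝ] 𝔸) : 𝔸 →L[ℝ] 𝔸) 0 :=
    hasStrictFDerivAt_exp_zero
  set L := hexp.localInverse with hL
  have hL1 : HasStrictFDerivAt L
      (((ContinuousLinearEquiv.refl ℝ 𝔸).symm : 𝔸 ≃L[ℝ] 𝔸) : 𝔸 →L[ℝ] 𝔸) 1 := by
    have := hexp.to_localInverse
    rwa [NormedSpace.exp_zero] at this
  have hLone : L 1 = 0 := by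
    have := hexp.localInverse_apply_image
    rwa [NormedSpace.exp_zero] at this
  have hcomp : HasDerivAt (fun s => L (γ s)) X 0 := by
    have h1 : HasFDerivAt L
      (((ContinuousLinearEquiv.refl ℝ 𝔸).symm : 𝔸 ≃L[ℝ] 𝔸) : 𝔸 →L[ℝ] 𝔸) (γ 0) := by
      rw [h0]; exact hL1.hasFDerivAt
    have h2 := h1.comp_hasDerivAt 0 hγ
    simp only [ContinuousLinearEquiv.coe_coe, ContinuousLinearEquiv.refl_symm,
      ContinuousLinearEquiv.coe_refl', id_eq] at h2
    exact h2
  have hinv0 : Tendsto (fun n : ℕ => ((n : ℝ)⁻¹)) atTop (𝓝 0) :=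
    tendsto_inv_atTop_zero.comp tendsto_natCast_atTop_atTop
  have hinv : Tendsto (fun n : ℕ => ((n : ℝ)⁻¹)) atTop (𝓝[≠] 0) := by
    refine tendsto_nhdsWithin_iff.2 ⟨hinv0, ?_⟩
    filter_upwards [eventually_gt_atTop 0] with n hn
    simpa using hn.ne'
  have hslope : Tendsto (fun n : ℕ => (n : ℕ) • L (γ ((n : ℝ)⁻¹))) atTop (𝓝 X) := by
    have := (hasDerivAt_iff_tendsto_slope.1 hcomp).comp hinv
    refine this.congr fun n => ?_
    simp [slope, h0, hLone, Nat.cast_smul_eq_nsmul]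
  have hlim : Tendsto (fun n : ℕ => NormedSpace.exp ((n : ℕ) • L (γ ((n : ℝ)⁻¹)))) atTop
      (𝓝 (NormedSpace.exp X)) :=
    (NormedSpace.exp_continuous.tendsto X).comp hslope
  refine hlim.congr' ?_
  have hγc : Tendsto (fun n : ℕ => γ ((n : ℝ)⁻¹)) atTop (𝓝 1) := by
    have := hγ.continuousAt.tendsto.comp hinv0
    rwa [h0] at this
  have hev : ∀ᶠ y in 𝓝 (1 : 𝔸), NormedSpace.exp (L y) = y := by
    have := hexp.eventually_right_inverse
    rwa [NormedSpace.exp_zero] at this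
  filter_upwards [hγc.eventually hev] with n hn
  rw [NormedSpace.exp_nsmul, hn]

theorem lie_product_formula (X Y : 𝔸) :
    Tendsto (fun n : ℕ => (NormedSpace.exp ((n : ℝ)⁻¹ • X) * NormedSpace.exp ((n : ℝ)⁻¹ • Y)) ^ n)
      atTop (𝓝 (NormedSpace.exp (X + Y))) := by
  refine tendsto_pow_exp_of_hasDerivAt
    (γ := fun s : ℝ => NormedSpace.exp (s • X) * NormedSpace.exp (s • Y)) (by simp) ?_
  have := (hasDerivAt_exp_smul_const (𝕂 := ℝ) X (0 : ℝ)).mul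
    (hasDerivAt_exp_smul_const (𝕂 := ℝ) Y (0 : ℝ))
  simp only [zero_smul, NormedSpace.exp_zero, one_mul, mul_one] at this
  exact this

end LieProduct

/-! ## The flat hyperkähler space `ℍ^d` and the group `Sp(d)` -/

/-- `ℍ^d` with its Euclidean inner product. -/
abbrev HSpace (d : ℕ) : Type := PiLp 2 (fun _ : Fin d => ℍ[ℝ])

/-- Quaternionic `d × d` matrices; `star` is the conjugate transpose `A†`. -/
abbrev HMat (d : ℕ) : Type := Matrix (Fin d) (Fin d) ℍ[ℝ]

/-- `Sp(d)`: quaternionic matrices with `A† A = A A† = 1`. -/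
abbrev Sp (d : ℕ) : Type := unitary (HMat d)

/-- Left multiplication of a column vector by a matrix. -/
def mulVec {d : ℕ} (A : HMat d) (q : HSpace d) : HSpace d := WithLp.toLp 2 (A *ᵥ q.ofLp)

/-- The standard linear action of `Sp(d)` on `ℍ^d`. -/
instance (d : ℕ) : MulAction (Sp d) (HSpace d) where
  smul A q := mulVec (A : HMat d) q
  one_smul q := by
    change mulVec (1 : HMat d) q = q
    simp [mulVec]
  mul_smul A B q := by
    change mulVec ((A : HMat d) * (B : HMat d)) q = mulVec (A : HMat d) (mulVec (B : HMat d) q)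
    simp [mulVec]

/-- The imaginary units `i, j, k`. -/
def imUnit : Fin 3 → ℍ[ℝ] := ![⟨0, 1, 0, 0⟩, ⟨0, 0, 1, 0⟩, ⟨0, 0, 0, 1⟩]

/-! ## The Lie algebra and the moment map of a closed subgroup -/

section Group

variable {d : ℕ}

/-- `A` generates a one-parameter subgroup of `G`. -/
def IsGenerator (G : Subgroup (Sp d)) (A : HMat d) : Prop :=
  ∀ t : ℝ, ∃ g ∈ G, ((g : Sp d) : HMat d) = NormedSpace.exp (t • A)

section

attribute [local instance] Matrix.linftyOpNormedRing Matrix.linftyOpNormedAlgebra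

theorem isClosed_coe_image (G : Subgroup (Sp d)) (hG : IsClosed (G : Set (Sp d))) :
    IsClosed ((Subtype.val : Sp d → HMat d) '' (G : Set (Sp d))) := by
  refine (IsClosed.isClosedEmbedding_subtypeVal ?_).isClosedMap _ hG
  have h1 : IsClosed {U : HMat d | star U * U = 1} :=
    isClosed_eq (continuous_star.mul continuous_id) continuous_const
  have h2 : IsClosed {U : HMat d | U * star U = 1} :=
    isClosed_eq (continuous_id.mul continuous_star) continuous_const
  exact h1.inter h2

theorem IsGenerator.add {G : Subgroup (Sp d)} (hG : IsClosed (G : Set (Sp d))) {A B : HMat d}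
    (hA : IsGenerator G A) (hB : IsGenerator G B) : IsGenerator G (A + B) := by
  intro t
  have hlim := lie_product_formula (t • A) (t • B)
  rw [← smul_add] at hlim
  have := (isClosed_coe_image G hG).mem_of_tendsto hlim (Eventually.of_forall fun n => by
    obtain ⟨a, ha, ha'⟩ := hA ((n : ℝ)⁻¹ * t)
    obtain ⟨b, hb, hb'⟩ := hB ((n : ℝ)⁻¹ * t)
    refine ⟨(a * b) ^ n, G.pow_mem (G.mul_mem ha hb) n, ?_⟩
    simp only [SubmonoidClass.coe_pow, Submonoid.coe_mul, ha', hb', smul_smul]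
    rfl)
  obtain ⟨g, hg, hg'⟩ := this
  exact ⟨g, hg, hg'⟩

end

/-- The Lie algebra `𝔤 = {A | exp (t A) ∈ G for all t}` of a closed subgroup `G` of `Sp(d)`, as a
real subspace of the quaternionic matrices. -/
def lieAlg (G : Subgroup (Sp d)) (hG : IsClosed (G : Set (Sp d))) : Submodule ℝ (HMat d) where
  carrier := {A | IsGenerator G A}
  add_mem' := fun hA hB => IsGenerator.add hG hA hB
  zero_mem' := fun t => ⟨1, G.one_mem, by simp⟩
  smul_mem' := fun s A hA t => by
    obtain ⟨g, hg, hg'⟩ := hA (t * s)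
    exact ⟨g, hg, by rw [hg', smul_smul]⟩

/-- Matrices as a Euclidean space, with inner product `⟪A, B⟫ = Re tr (A B†)`. -/
def matEuclid (d : ℕ) : HMat d ≃ₗ[ℝ] PiLp 2 (fun _ : Fin d × Fin d => ℍ[ℝ]) where
  toFun A := WithLp.toLp 2 fun p => A p.1 p.2
  invFun v := Matrix.of fun a b => v (a, b)
  map_add' _ _ := rfl
  map_smul' _ _ := rfl
  left_inv _ := rfl
  right_inv _ := rfl

/-- The matrices `q i q†`, `q j q†`, `q k q†` (for `l = 0, 1, 2`). -/
def spMoment (l : Fin 3) (q : HSpace d) : HMat d :=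
  Matrix.of fun a b => q a * imUnit l * star (q b)

variable (G : Subgroup (Sp d)) (hG : IsClosed (G : Set (Sp d)))

/-- The hyperkähler moment map `μ = (μ₁, μ₂, μ₃)` of `G`: the orthogonal projections of
`q i q†`, `q j q†`, `q k q†` onto `𝔤`. -/
def momentMap (l : Fin 3) (q : HSpace d) : HMat d :=
  (matEuclid d).symm
    (((lieAlg G hG).map (matEuclid d).toLinearMap).starProjection (matEuclid d (spMoment l q)))

/-- `A` lies in the centre of the Lie algebra `𝔤`. -/
def IsCentral (A : HMat d) : Prop :=
  A ∈ lieAlg G hG ∧ ∀ B ∈ lieAlg G hG, A * B = B * A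

/-- `μ⁻¹(c)`. -/
def levelSet (c : Fin 3 → HMat d) : Set (HSpace d) := {q | ∀ l, momentMap G hG l q = c l}

/-- `G` acts freely on the set `S`: it preserves `S` and all stabilizers are trivial. -/
def ActsFreelyOn (S : Set (HSpace d)) : Prop :=
  (∀ g ∈ G, ∀ q ∈ S, g • q ∈ S) ∧ ∀ q ∈ S, MulAction.stabilizer G q = ⊥

/-- `G` acts locally freely on the set `S`: the stabilizers of its points are discrete. (This is
used for `μ⁻¹(0) ∖ {0}`, which is automatically preserved by `G`.) -/
def ActsLocallyFreelyOn (S : Set (HSpace d)) : Prop :=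
  ∀ q ∈ S, DiscreteTopology (MulAction.stabilizer G q)

/-- The tangent space `{ρ q | ρ ∈ 𝔤}` of the orbit at `q`. -/
def orbitTangent (q : HSpace d) : Submodule ℝ (HSpace d) where
  carrier := {v | ∃ A ∈ lieAlg G hG, mulVec A q = v}
  add_mem' := by
    rintro _ _ ⟨A, hA, rfl⟩ ⟨B, hB, rfl⟩
    exact ⟨A + B, add_mem hA hB, by simp [mulVec, Matrix.add_mulVec]⟩
  zero_mem' := ⟨0, zero_mem _, by simp [mulVec]⟩
  smul_mem' := by
    rintro t _ ⟨A, hA, rfl⟩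
    exact ⟨t • A, (lieAlg G hG).smul_mem t hA, by simp [mulVec, Matrix.smul_mulVec]⟩

/-! ## The hyperkähler quotient -/

/-- Points of `μ⁻¹(c)` are equivalent if they lie in the same `G`-orbit. -/
def orbitSetoid (c : Fin 3 → HMat d) : Setoid (levelSet G hG c) :=
  (MulAction.orbitRel G (HSpace d)).comap Subtype.val

/-- The quotient `Q = μ⁻¹(c)/G`, with the quotient topology. -/
def QuotSpace (c : Fin 3 → HMat d) : Type := Quotient (orbitSetoid G hG c)

instance (c : Fin 3 → HMat d) : TopologicalSpace (QuotSpace G hG c) :=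
  inferInstanceAs (TopologicalSpace (Quotient (orbitSetoid G hG c)))

/-- The projection `μ⁻¹(c) → Q`. -/
def proj (c : Fin 3 → HMat d) (q : levelSet G hG c) : QuotSpace G hG c :=
  Quotient.mk (orbitSetoid G hG c) q

/-- `dim Q = 4 d - 4 dim G`. -/
def quotDim : ℕ := 4 * d - 4 * Module.finrank ℝ (lieAlg G hG)

/-- A smooth chart of the quotient manifold `Q`, written as a parametrization: a homeomorphism from
an open set `U ⊆ ℝⁿ`, `n = dim Q`, onto an open subset of `Q`, induced by a smooth map
`U → μ⁻¹(c)` that is transverse to the `G`-orbits (a local slice). -/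
structure Chart (c : Fin 3 → HMat d) where
  /-- the parameter domain `U` -/
  source : Set (EuclideanSpace ℝ (Fin (quotDim G hG)))
  isOpen_source : IsOpen source
  /-- the local slice -/
  slice : EuclideanSpace ℝ (Fin (quotDim G hG)) → HSpace d
  contDiffOn_slice : ContDiffOn ℝ ∞ slice source
  slice_mem : ∀ x ∈ source, slice x ∈ levelSet G hG c
  transverse : ∀ x ∈ source, ∀ u, fderiv ℝ slice x u ∈ orbitTangent G hG (slice x) → u = 0
  isOpenEmbedding :
    Topology.IsOpenEmbedding fun x : source => proj G hG c ⟨slice x, slice_mem x x.2⟩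

variable {G hG}

/-- The point of `Q` with parameter `x`. -/
def Chart.point {c : Fin 3 → HMat d} (φ : Chart G hG c) (x : φ.source) : QuotSpace G hG c :=
  proj G hG c ⟨φ.slice x, φ.slice_mem x x.2⟩

/-- The matrix `(g_ab)` in the chart `φ` of the quotient metric, for which the projection
`μ⁻¹(c) → Q` is a Riemannian submersion: the inner product of the components of `∂_a φ` and `∂_b φ`
orthogonal to the orbit. -/
def Chart.metric {c : Fin 3 → HMat d} (φ : Chart G hG c)
    (x : EuclideanSpace ℝ (Fin (quotDim G hG))) :
    Matrix (Fin (quotDim G hG)) (Fin (quotDim G hG)) ℝ :=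
  Matrix.of fun a b =>
    inner ℝ
      ((orbitTangent G hG (φ.slice x))ᗮ.starProjection
        (fderiv ℝ φ.slice x (EuclideanSpace.single a 1)))
      ((orbitTangent G hG (φ.slice x))ᗮ.starProjection
        (fderiv ℝ φ.slice x (EuclideanSpace.single b 1)))

end Group

/-! ## Sectional curvature of a Riemannian metric in coordinates -/

section Curvature

variable {n : ℕ}

/-- The partial derivative `∂_i f`. -/
def pderiv (i : Fin n) (f : EuclideanSpace ℝ (Fin n) → ℝ) (x : EuclideanSpace ℝ (Fin n)) : ℝ :=
  fderiv ℝ f x (EuclideanSpace.single i 1)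

variable (g : EuclideanSpace ℝ (Fin n) → Matrix (Fin n) (Fin n) ℝ)

/-- The Christoffel symbol `Γ^k_ij` of the Levi-Civita connection of `g`. -/
def christoffel (k i j : Fin n) (x : EuclideanSpace ℝ (Fin n)) : ℝ :=
  (1 / 2) * ∑ l, (g x)⁻¹ k l *
    (pderiv i (fun y => g y j l) x + pderiv j (fun y => g y i l) x - pderiv l (fun y => g y i j) x)

/-- The component `R^l_kij` of the Riemann tensor: `R(∂_i, ∂_j) ∂_k = ∑ l, R^l_kij ∂_l`, where
`R(X, Y) = [∇_X, ∇_Y] - ∇_[X, Y]`. -/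
def riemann (l k i j : Fin n) (x : EuclideanSpace ℝ (Fin n)) : ℝ :=
  pderiv i (christoffel g l j k) x - pderiv j (christoffel g l i k) x
    + ∑ m, (christoffel g l i m x * christoffel g m j k x
      - christoffel g l j m x * christoffel g m i k x)

/-- `g_x(u, v)`. -/
def metricForm (x u v : EuclideanSpace ℝ (Fin n)) : ℝ := ∑ i, ∑ j, g x i j * u i * v j

/-- `R(u, v) w` at `x`. -/
def riemannVec (x u v w : EuclideanSpace ℝ (Fin n)) : EuclideanSpace ℝ (Fin n) :=
  WithLp.toLp 2 fun l => ∑ k, ∑ i, ∑ j, riemann g l k i j x * u i * v j * w k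

/-- The sectional curvature at `x` of the plane spanned by `u` and `v`. -/
def sectionalCurvature (x u v : EuclideanSpace ℝ (Fin n)) : ℝ :=
  metricForm g x (riemannVec g x u v v) u /
    (metricForm g x u u * metricForm g x v v - metricForm g x u v ^ 2)

end Curvature

/-- The set of all sectional curvatures `K_Q(p)(π)`, where `π` runs over the planes in `T_p Q`. -/
def sectionalCurvatures {d : ℕ} {G : Subgroup (Sp d)} {hG : IsClosed (G : Set (Sp d))}
    {c : Fin 3 → HMat d} (p : QuotSpace G hG c) : Set ℝ :=
  {K | ∃ (φ : Chart G hG c) (x : φ.source) (u v : EuclideanSpace ℝ (Fin (quotDim G hG))),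
    φ.point x = p ∧ LinearIndependent ℝ ![u, v] ∧ K = sectionalCurvature φ.metric x u v}

/-- The curvature of `Q` is asymptotically null: the sectional curvatures tend uniformly to zero at
infinity, i.e. they are smaller than any given `ε > 0` outside a compact subset of `Q`. -/
def AsymptoticallyNullCurvature {d : ℕ} (G : Subgroup (Sp d)) (hG : IsClosed (G : Set (Sp d)))
    (c : Fin 3 → HMat d) : Prop :=
  ∀ ε > 0, ∃ C : Set (QuotSpace G hG c), IsCompact C ∧
    ∀ p ∉ C, ∀ K ∈ sectionalCurvatures p, |K| < ε

end HKQuot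

end

/-!
Let `s : U → μ⁻¹(c)` be a slice and let `A(u) ∈ 𝔤` be the element whose value at `s x` is the
vertical part of `∂_u s`. Then `∇ = ∂ - A` is a metric connection on the trivial bundle with fibre
`ℍ^d`. The torsion `∇_u ∇_v s - ∇_v ∇_u s = -F(u, v) s` of the horizontal frame `∇ s`, where `F` is
the curvature of `∇`, is vertical. The Gauss equation therefore expresses the curvature of `Q`
through `F` and the second fundamental form `B`, that is the component of `∇ ∇ s` orthogonal to the
horizontal space.
Since `μ⁻¹(c)` is cut out by a hyperkähler moment map, that orthogonal complement is spanned by the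
vectors `J T s` with `J ∈ {1, i, j, k}` and `T ∈ 𝔤`, and pairing `∇ ∇ s` and `F` with these vectors
bounds both in terms of any `δ` with `δ ‖T‖ ≤ ‖T s‖` for all `T ∈ 𝔤`: the sectional curvatures are
`O(δ⁻²)`. The moment map is homogeneous and the infinitesimal action is injective at all nonzero
points of its zero set, so by compactness of the unit sphere `δ` may be taken proportional to `‖s‖`
far from the origin.
-/

noncomputable section

local notation:max "𝔼" n:max => EuclideanSpace ℝ (Fin n)

namespace HKQuot

/-! ## Closed groups in a Banach algebra -/

theorem mem_of_hasDerivAt {E : Type*} [NormedAddCommGroup E] [NormedSpace ℝ E] {W : Submodule ℝ E}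
    (hW : IsClosed (W : Set E)) {γ : ℝ → E} {v : E} {t : ℝ} (hγ : HasDerivAt γ v t)
    (hmem : ∀ s, γ s ∈ W) : v ∈ W :=
  hW.mem_of_tendsto (hasDerivAt_iff_tendsto_slope.1 hγ)
    (Eventually.of_forall fun s => W.smul_mem _ (W.sub_mem (hmem s) (hmem t)))

section Exponential

variable {𝔸 : Type*} [NormedRing 𝔸] [NormedAlgebra ℝ 𝔸] [CompleteSpace 𝔸]

theorem exp_mul_exp_neg (X : 𝔸) : NormedSpace.exp X * NormedSpace.exp (-X) = 1 :=
  let _ : NormedAlgebra ℚ 𝔸 := NormedAlgebra.restrictScalars ℚ ℝ 𝔸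
  let _ := NormedSpace.invertibleExp X
  mul_invOf_self (NormedSpace.exp X)

theorem exp_neg_mul_exp (X : 𝔸) : NormedSpace.exp (-X) * NormedSpace.exp X = 1 := by
  simpa only [neg_neg] using exp_mul_exp_neg (-X)

theorem hasDerivAt_exp_smul_zero (X : 𝔸) :
    HasDerivAt (fun t : ℝ => NormedSpace.exp (t • X)) X 0 := by
  simpa only [zero_smul, NormedSpace.exp_zero, one_mul] using
    hasDerivAt_exp_smul_const (𝕂 := ℝ) X (0 : ℝ)

theorem continuous_exp_smul (X : 𝔸) : Continuous fun t : ℝ => NormedSpace.exp (t • X) :=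
  continuous_iff_continuousAt.2 fun t => (hasDerivAt_exp_smul_const (𝕂 := ℝ) X t).continuousAt

theorem eq_zero_of_forall_exp_smul_eq_one {X : 𝔸} (h : ∀ t : ℝ, NormedSpace.exp (t • X) = 1) :
    X = 0 := by
  have hderiv := hasDerivAt_exp_smul_zero X
  simp only [h] at hderiv
  exact hderiv.unique (hasDerivAt_const 0 1)

theorem tendsto_floor_div_mul {r : ℕ → ℝ} (hr : Tendsto r atTop (𝓝 0)) (hpos : ∀ n, 0 < r n)
    {t : ℝ} (ht : 0 ≤ t) : Tendsto (fun n => (⌊t / r n⌋₊ : ℝ) * r n) atTop (𝓝 t) := by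
  have hlower : Tendsto (fun n => t - r n) atTop (𝓝 t) := by
    simpa only [sub_zero] using (tendsto_const_nhds (x := t)).sub hr
  refine tendsto_of_tendsto_of_tendsto_of_le_of_le hlower tendsto_const_nhds (fun n => ?_)
    fun n => (le_div_iff₀ (hpos n)).1 (Nat.floor_le (div_nonneg ht (hpos n).le))
  have hfloor := (div_lt_iff₀ (hpos n)).1 (Nat.lt_floor_add_one (t / r n))
  dsimp only
  linarith

/-- The power `exp (Y n) ^ ⌊t / ‖Y n‖⌋` belongs to `S` and tends to `exp (t • u)`. -/
theorem exp_smul_mem_of_tendsto {S : Submonoid 𝔸} (hS : IsClosed (S : Set 𝔸)) {Y : ℕ → 𝔸}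
    (hY : Tendsto Y atTop (𝓝 0)) (hY0 : ∀ n, Y n ≠ 0) (hYS : ∀ n, NormedSpace.exp (Y n) ∈ S)
    {u : 𝔸} (hu : Tendsto (fun n => ‖Y n‖⁻¹ • Y n) atTop (𝓝 u)) {t : ℝ} (ht : 0 ≤ t) :
    NormedSpace.exp (t • u) ∈ S := by
  let _ : NormedAlgebra ℚ 𝔸 := NormedAlgebra.restrictScalars ℚ ℝ 𝔸
  have hpos : ∀ n, 0 < ‖Y n‖ := fun n => norm_pos_iff.2 (hY0 n)
  have hscale := (tendsto_floor_div_mul (tendsto_zero_iff_norm_tendsto_zero.1 hY) hpos ht).smul hu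
  have hlim : Tendsto (fun n => NormedSpace.exp (⌊t / ‖Y n‖⌋₊ • Y n)) atTop
      (𝓝 (NormedSpace.exp (t • u))) := by
    refine (NormedSpace.exp_continuous.tendsto _).comp (hscale.congr fun n => ?_)
    rw [smul_smul, mul_assoc, mul_inv_cancel₀ (hpos n).ne', mul_one, Nat.cast_smul_eq_nsmul]
  refine hS.mem_of_tendsto hlim (Eventually.of_forall fun n => ?_)
  rw [NormedSpace.exp_nsmul]
  exact S.pow_mem (hYS n) _

end Exponential

/-- `S` is a closed group of invertible elements of the Banach algebra `𝔸`, with Lie algebra `𝔥`.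
The group is encoded as a submonoid closed under inverses so that it carries the topology of `𝔸`
rather than that of the group of units. -/
structure IsClosedGroup {𝔸 : Type*} [NormedRing 𝔸] [NormedAlgebra ℝ 𝔸] (S : Submonoid 𝔸)
    (𝔥 : Submodule ℝ 𝔸) : Prop where
  isClosed : IsClosed (S : Set 𝔸)
  inv_mem : ∀ x ∈ S, ∀ y, x * y = 1 → y ∈ S
  mem_lie_iff : ∀ X, X ∈ 𝔥 ↔ ∀ t : ℝ, NormedSpace.exp (t • X) ∈ S

namespace IsClosedGroup

variable {𝔸 : Type*} [NormedRing 𝔸] [NormedAlgebra ℝ 𝔸] {S : Submonoid 𝔸} {𝔥 : Submodule ℝ 𝔸}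
  (hS : IsClosedGroup S 𝔥)

include hS

theorem exp_smul_mem {X : 𝔸} (hX : X ∈ 𝔥) (t : ℝ) : NormedSpace.exp (t • X) ∈ S :=
  (hS.mem_lie_iff X).1 hX t

theorem exp_mem {X : 𝔸} (hX : X ∈ 𝔥) : NormedSpace.exp X ∈ S := by
  simpa only [one_smul] using hS.exp_smul_mem hX 1

theorem mem_lie_of_nonneg [CompleteSpace 𝔸] {X : 𝔸}
    (hX : ∀ t : ℝ, 0 ≤ t → NormedSpace.exp (t • X) ∈ S) : X ∈ 𝔥 := by
  refine (hS.mem_lie_iff X).2 fun t => ?_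
  rcases le_total 0 t with ht | ht
  · exact hX t ht
  · refine hS.inv_mem _ (hX (-t) (neg_nonneg.2 ht)) _ ?_
    rw [neg_smul, exp_neg_mul_exp]

theorem exp_conj_mem_lie [CompleteSpace 𝔸] {X Y : 𝔸} (hX : X ∈ 𝔥) (hY : Y ∈ 𝔥) :
    NormedSpace.exp X * Y * NormedSpace.exp (-X) ∈ 𝔥 := by
  let _ : NormedAlgebra ℚ 𝔸 := NormedAlgebra.restrictScalars ℚ ℝ 𝔸
  let g : 𝔸ˣ := ⟨NormedSpace.exp X, NormedSpace.exp (-X), exp_mul_exp_neg X, exp_neg_mul_exp X⟩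
  refine (hS.mem_lie_iff _).2 fun t => ?_
  have hconj : NormedSpace.exp (t • ((g : 𝔸) * Y * (↑g⁻¹ : 𝔸))) =
      g * NormedSpace.exp (t • Y) * (↑g⁻¹ : 𝔸) := by
    rw [← NormedSpace.exp_units_conj, mul_smul_comm, smul_mul_assoc]
  exact hconj ▸ S.mul_mem (S.mul_mem (hS.exp_mem hX) (hS.exp_smul_mem hY t))
    (hS.exp_mem (𝔥.neg_mem hX))

variable [FiniteDimensional ℝ 𝔸]

theorem mul_sub_mul_mem_lie {X Y : 𝔸} (hX : X ∈ 𝔥) (hY : Y ∈ 𝔥) : X * Y - Y * X ∈ 𝔥 := by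
  have : CompleteSpace 𝔸 := FiniteDimensional.complete ℝ 𝔸
  have hconj : ∀ t : ℝ, NormedSpace.exp (t • X) * Y * NormedSpace.exp (t • -X) ∈ 𝔥 := fun t =>
    smul_neg t X ▸ hS.exp_conj_mem_lie (𝔥.smul_mem t hX) hY
  have hderiv := ((hasDerivAt_exp_smul_zero X).mul_const Y).mul (hasDerivAt_exp_smul_zero (-X))
  simp only [zero_smul, NormedSpace.exp_zero, mul_one, one_mul, mul_neg, ← sub_eq_add_neg]
    at hderiv
  exact mem_of_hasDerivAt 𝔥.closed_of_finiteDimensional hderiv hconj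

theorem eventually_eq_zero_of_disjoint {W : Submodule ℝ 𝔸} (hW : Disjoint 𝔥 W) :
    ∀ᶠ Y in 𝓝 (0 : 𝔸), Y ∈ W → NormedSpace.exp Y ∈ S → Y = 0 := by
  have : CompleteSpace 𝔸 := FiniteDimensional.complete ℝ 𝔸
  have : ProperSpace 𝔸 := FiniteDimensional.proper ℝ 𝔸
  by_contra hcon
  rw [not_eventually] at hcon
  obtain ⟨Y, hY, hYp⟩ := exists_seq_forall_of_frequently hcon
  push Not at hYp
  choose hYW hYS hY0 using hYp
  have hsphere : ∀ n, ‖Y n‖⁻¹ • Y n ∈ Metric.sphere (0 : 𝔸) 1 := fun n => by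
    rw [mem_sphere_zero_iff_norm, norm_smul, norm_inv, norm_norm,
      inv_mul_cancel₀ (norm_ne_zero_iff.2 (hY0 n))]
  obtain ⟨u, hu, φ, hφ, hlim⟩ := (isCompact_sphere (0 : 𝔸) 1).tendsto_subseq hsphere
  have hu𝔥 : u ∈ 𝔥 := hS.mem_lie_of_nonneg fun t ht =>
    exp_smul_mem_of_tendsto hS.isClosed (hY.comp hφ.tendsto_atTop) (fun n => hY0 (φ n))
      (fun n => hYS (φ n)) hlim ht
  have huW : u ∈ W := W.closed_of_finiteDimensional.mem_of_tendsto hlim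
    (Eventually.of_forall fun n => W.smul_mem _ (hYW (φ n)))
  have hu0 : u = 0 := Submodule.disjoint_def.1 hW u hu𝔥 huW
  rw [mem_sphere_zero_iff_norm, hu0, norm_zero] at hu
  exact zero_ne_one hu

omit hS in
theorem hasStrictFDerivAt_exp_mul_exp_sub (P : 𝔸 →L[ℝ] 𝔸) :
    HasStrictFDerivAt (fun Z => NormedSpace.exp (P Z) * NormedSpace.exp (Z - P Z))
      (ContinuousLinearMap.id ℝ 𝔸) 0 := by
  have : CompleteSpace 𝔸 := FiniteDimensional.complete ℝ 𝔸
  let _ : NormedAlgebra ℚ 𝔸 := NormedAlgebra.restrictScalars ℚ ℝ 𝔸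
  have hexp : ∀ L : 𝔸 →L[ℝ] 𝔸, HasStrictFDerivAt (fun Z => NormedSpace.exp (L Z)) L 0 := fun L =>
    HasStrictFDerivAt.comp (g' := 1) 0 (by rw [map_zero]; exact hasStrictFDerivAt_exp_zero)
      L.hasStrictFDerivAt
  refine ((hexp P).mul' (hexp (ContinuousLinearMap.id ℝ 𝔸 - P))).congr_fderiv ?_
  ext Z
  simp

/-- Cartan's theorem: `exp` parametrizes the group near `1` by its Lie algebra. For a complement `W`
of `𝔥`, the map `(X, Y) ↦ exp X * exp Y` covers a neighbourhood of `1`, and the `W`-component of an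
element of the group vanishes. -/
theorem eventually_exists_exp_eq {ε : ℝ} (hε : 0 < ε) :
    ∀ᶠ g in 𝓝 (1 : 𝔸), g ∈ S → ∃ X ∈ 𝔥, ‖X‖ < ε ∧ NormedSpace.exp X = g := by
  have : CompleteSpace 𝔸 := FiniteDimensional.complete ℝ 𝔸
  obtain ⟨W, hW⟩ := 𝔥.exists_isCompl
  let P : 𝔸 →L[ℝ] 𝔸 := LinearMap.toContinuousLinearMap (𝔥.projection W hW)
  have hP𝔥 : ∀ Z, P Z ∈ 𝔥 := Submodule.projection_apply_mem hW
  have hPW : ∀ Z, Z - P Z ∈ W := fun Z => by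
    rw [← Submodule.ker_projection hW, LinearMap.mem_ker, map_sub, sub_eq_zero]
    exact ((Submodule.projection_eq_self_iff hW _).2 (hP𝔥 Z)).symm
  have hnhds := (hasStrictFDerivAt_exp_mul_exp_sub P).map_nhds_eq_of_equiv
    (f' := ContinuousLinearEquiv.refl ℝ 𝔸)
  simp only [map_zero, sub_zero, NormedSpace.exp_zero, mul_one] at hnhds
  rw [← hnhds, eventually_map]
  have hsub : Tendsto (fun Z => Z - P Z) (𝓝 0) (𝓝 0) :=
    Continuous.tendsto' (by fun_prop) 0 0 (by rw [map_zero, sub_zero])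
  have hnorm : Tendsto (fun Z => ‖P Z‖) (𝓝 0) (𝓝 0) :=
    Continuous.tendsto' (by fun_prop) 0 0 (by rw [map_zero, norm_zero])
  filter_upwards [hsub.eventually (hS.eventually_eq_zero_of_disjoint hW.disjoint),
    hnorm.eventually (gt_mem_nhds hε)] with Z hZ hZε hZS
  have hexp_sub : NormedSpace.exp (Z - P Z) ∈ S := by
    have hmem := S.mul_mem (hS.exp_mem (𝔥.neg_mem (hP𝔥 Z))) hZS
    rwa [← mul_assoc, exp_neg_mul_exp, one_mul] at hmem
  exact ⟨P Z, hP𝔥 Z, hZε, by rw [hZ (hPW Z) hexp_sub, NormedSpace.exp_zero, mul_one]⟩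

end IsClosedGroup

/-- `S` is a closed group of linear isometries of `V`, with Lie algebra `𝔥`. -/
structure IsIsometryGroup {V : Type*} [NormedAddCommGroup V] [NormedSpace ℝ V]
    (S : Submonoid (V →L[ℝ] V)) (𝔥 : Submodule ℝ (V →L[ℝ] V)) : Prop
    extends IsClosedGroup S 𝔥 where
  norm_apply : ∀ T ∈ S, ∀ v, ‖T v‖ = ‖v‖

section OneParameter

variable {V : Type*} [NormedAddCommGroup V] [NormedSpace ℝ V] [CompleteSpace V]

theorem hasDerivAt_exp_smul_apply (X : V →L[ℝ] V) (v : V) (t : ℝ) :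
    HasDerivAt (fun t : ℝ => NormedSpace.exp (t • X) v) (NormedSpace.exp (t • X) (X v)) t := by
  simpa using (hasDerivAt_exp_smul_const (𝕂 := ℝ) X t).clm_apply (hasDerivAt_const t v)

theorem exp_smul_apply_eq_self {X : V →L[ℝ] V} {v : V} (h : X v = 0) (t : ℝ) :
    NormedSpace.exp (t • X) v = v := by
  have hderiv : ∀ t, HasDerivAt (fun t : ℝ => NormedSpace.exp (t • X) v) 0 t := fun t => by
    simpa only [h, map_zero] using hasDerivAt_exp_smul_apply X v t
  have hconst := is_const_of_deriv_eq_zero (fun t => (hderiv t).differentiableAt)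
    (fun t => (hderiv t).deriv) t 0
  simpa using hconst

end OneParameter

namespace IsIsometryGroup

variable {V : Type*} [NormedAddCommGroup V] [NormedSpace ℝ V]
  {S : Submonoid (V →L[ℝ] V)} {𝔥 : Submodule ℝ (V →L[ℝ] V)} (hS : IsIsometryGroup S 𝔥)

include hS

variable [FiniteDimensional ℝ V]

theorem isCompact : IsCompact (S : Set (V →L[ℝ] V)) := by
  have : ProperSpace (V →L[ℝ] V) := FiniteDimensional.proper ℝ _
  refine (isCompact_closedBall (0 : V →L[ℝ] V) 1).of_isClosed_subset hS.isClosed fun T hT => ?_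
  rw [mem_closedBall_zero_iff]
  exact T.opNorm_le_bound zero_le_one fun v => by rw [hS.norm_apply T hT, one_mul]

theorem exists_exp_of_norm_sub_lt {q : V} (hfree : ∀ T ∈ S, T q = q → T = 1) {ε : ℝ} (hε : 0 < ε) :
    ∃ η > 0, ∀ T ∈ S, ‖T q - q‖ < η → ∃ X ∈ 𝔥, ‖X‖ < ε ∧ NormedSpace.exp X = T := by
  obtain ⟨r, hr, hball⟩ := Metric.eventually_nhds_iff_ball.1 (hS.eventually_exists_exp_eq hε)
  have hcompact : IsCompact ((S : Set (V →L[ℝ] V)) \ Metric.ball 1 r) :=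
    hS.isCompact.diff Metric.isOpen_ball
  have hcont : Continuous fun T : V →L[ℝ] V => ‖T q - q‖ := by fun_prop
  obtain ⟨η, hη, hle⟩ := hcompact.exists_forall_le' hcont.continuousOn (a := 0)
    fun T ⟨hTS, hTr⟩ => by
      rw [norm_pos_iff, sub_ne_zero]
      exact fun h => hTr (hfree T hTS h ▸ Metric.mem_ball_self hr)
  refine ⟨η, hη, fun T hT hlt => hball T (by_contra fun hTr => ?_) hT⟩
  exact (hle T ⟨hT, hTr⟩).not_gt hlt

end IsIsometryGroup

theorem IsIsometryGroup.inner_apply_left {V : Type*} [NormedAddCommGroup V] [InnerProductSpace ℝ V]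
    [CompleteSpace V] {S : Submonoid (V →L[ℝ] V)} {𝔥 : Submodule ℝ (V →L[ℝ] V)}
    (hS : IsIsometryGroup S 𝔥) {T : V →L[ℝ] V} (hT : T ∈ 𝔥) (v w : V) :
    inner ℝ (T v) w = -inner ℝ v (T w) := by
  have hdiag : ∀ v, inner ℝ v (T v) = (0 : ℝ) := fun v => by
    have hderiv := (hasDerivAt_exp_smul_apply T v 0).norm_sq
    simp only [hS.norm_apply _ (hS.exp_smul_mem hT _)] at hderiv
    simpa using hderiv.unique (hasDerivAt_const _ _)
  have hpolar := hdiag (v + w)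
  rw [map_add, inner_add_left, inner_add_right, inner_add_right, hdiag, hdiag] at hpolar
  linarith [real_inner_comm w (T v)]

/-! ## Connections on a trivial bundle -/

section Connection

variable {E V : Type*} [NormedAddCommGroup E] [NormedSpace ℝ E] [NormedAddCommGroup V]

/-- The covariant derivative `∇_u Y = ∂_u Y - A(u) Y` of a `V`-valued function `Y` on `E`, for the
connection `∇ = ∂ - A` on the trivial bundle with fibre `V`. -/
def covDeriv [NormedSpace ℝ V] (A : E → E →L[ℝ] V →L[ℝ] V) (Y : E → V) (x u : E) : V :=
  fderiv ℝ Y x u - A x u (Y x)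

/-- The curvature `F(u, v) = ∂_u A(v) - ∂_v A(u) - [A(u), A(v)]` of the connection `∇ = ∂ - A`; with
this sign `[∇_u, ∇_v] = -F(u, v)`. -/
def connCurvature [NormedSpace ℝ V] (A : E → E →L[ℝ] V →L[ℝ] V) (x : E) :
    E →L[ℝ] E →L[ℝ] V →L[ℝ] V :=
  fderiv ℝ A x - (fderiv ℝ A x).flip -
    (ContinuousLinearMap.mul ℝ (V →L[ℝ] V) -
      (ContinuousLinearMap.mul ℝ (V →L[ℝ] V)).flip).bilinearComp (A x) (A x)

theorem connCurvature_apply [NormedSpace ℝ V] (A : E → E →L[ℝ] V →L[ℝ] V) (x u v : E) :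
    connCurvature A x u v =
      fderiv ℝ A x u v - fderiv ℝ A x v u - (A x u * A x v - A x v * A x u) :=
  rfl

theorem connCurvature_self [NormedSpace ℝ V] (A : E → E →L[ℝ] V →L[ℝ] V) (x u : E) :
    connCurvature A x u u = 0 := by
  simp only [connCurvature_apply, sub_self]

theorem covDeriv_clm_apply [NormedSpace ℝ V] {W : Type*} [NormedAddCommGroup W] [NormedSpace ℝ W]
    {A : E → E →L[ℝ] V →L[ℝ] V} {X : E → W →L[ℝ] V} {Z : E → W} {x : E}
    (hX : DifferentiableAt ℝ X x) (hZ : DifferentiableAt ℝ Z x) (u : E) :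
    covDeriv A (fun y => X y (Z y)) x u =
      X x (fderiv ℝ Z x u) + (fderiv ℝ X x u (Z x) - A x u (X x (Z x))) := by
  rw [covDeriv, fderiv_clm_apply hX hZ]
  simp only [_root_.add_apply, ContinuousLinearMap.comp_apply, ContinuousLinearMap.flip_apply]
  abel

theorem covDeriv_covDeriv [NormedSpace ℝ V] {A : E → E →L[ℝ] V →L[ℝ] V} {Y : E → V} {x : E}
    (hA : DifferentiableAt ℝ A x) (hY : ContDiffAt ℝ 2 Y x) (u v : E) :
    covDeriv A (fun y => covDeriv A Y y v) x u =
      fderiv ℝ (fderiv ℝ Y) x u v - fderiv ℝ A x u v (Y x) - A x v (fderiv ℝ Y x u)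
        - A x u (fderiv ℝ Y x v) + A x u (A x v (Y x)) := by
  have hY' : DifferentiableAt ℝ (fderiv ℝ Y) x :=
    (hY.fderiv_right (m := 1) (by norm_cast)).differentiableAt (by simp)
  have hY'v := hY'.hasFDerivAt.clm_apply (hasFDerivAt_const v x)
  have hAv := (hA.hasFDerivAt.clm_apply (hasFDerivAt_const v x)).clm_apply
    (hY.differentiableAt (by simp)).hasFDerivAt
  have hderiv : fderiv ℝ (fun y => covDeriv A Y y v) x = _ := (hY'v.sub hAv).fderiv
  rw [covDeriv, hderiv]
  simp only [covDeriv, ContinuousLinearMap.comp_zero, zero_add, _root_.sub_apply, _root_.add_apply,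
    ContinuousLinearMap.flip_apply, ContinuousLinearMap.comp_apply, map_sub]
  abel

theorem covDeriv_comm [NormedSpace ℝ V] {A : E → E →L[ℝ] V →L[ℝ] V} {Y : E → V} {x : E}
    (hA : DifferentiableAt ℝ A x) (hY : ContDiffAt ℝ 2 Y x) (u v : E) :
    covDeriv A (fun y => covDeriv A Y y v) x u - covDeriv A (fun y => covDeriv A Y y u) x v =
      -connCurvature A x u v (Y x) := by
  have hsymm : fderiv ℝ (fderiv ℝ Y) x u v = fderiv ℝ (fderiv ℝ Y) x v u :=
    (hY.isSymmSndFDerivAt (by simp)).eq u v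
  rw [covDeriv_covDeriv hA hY, covDeriv_covDeriv hA hY, hsymm, connCurvature_apply]
  simp only [_root_.sub_apply, mul_apply_eq_comp]
  abel

theorem fderiv_inner_eq_covDeriv [InnerProductSpace ℝ V] {A : E → E →L[ℝ] V →L[ℝ] V} {Y Z : E → V}
    {x u : E} (hA : ∀ v w, inner ℝ (A x u v) w = -inner ℝ v (A x u w))
    (hY : DifferentiableAt ℝ Y x) (hZ : DifferentiableAt ℝ Z x) :
    fderiv ℝ (fun y => inner ℝ (Y y) (Z y)) x u =
      inner ℝ (covDeriv A Y x u) (Z x) + inner ℝ (Y x) (covDeriv A Z x u) := by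
  rw [fderiv_inner_apply ℝ hY hZ]
  simp only [covDeriv, inner_sub_left, inner_sub_right, hA]
  ring

end Connection

/-! ## Christoffel symbols and the Riemann tensor as multilinear maps -/

section Christoffel

variable {n : ℕ}

theorem clm_apply_eq_sum_single {M : Type*} [AddCommGroup M] [Module ℝ M] [TopologicalSpace M]
    (L : 𝔼 n →L[ℝ] M) (u : 𝔼 n) : L u = ∑ i, u i • L (EuclideanSpace.single i 1) := by
  conv_lhs => rw [← (EuclideanSpace.basisFun (Fin n) ℝ).sum_repr u]
  simp

variable (g : 𝔼 n → Matrix (Fin n) (Fin n) ℝ)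

/-- The Christoffel symbols of `g` at `x` as a bilinear map: `Γ(u, v)` has the components
`∑ i j, Γ^k_ij u_i v_j`. -/
def christoffelMap (x : 𝔼 n) : 𝔼 n →L[ℝ] 𝔼 n →L[ℝ] 𝔼 n :=
  ∑ k, ∑ j, ∑ i, christoffel g k i j x • (EuclideanSpace.proj i : 𝔼 n →L[ℝ] ℝ).smulRight
    ((EuclideanSpace.proj j : 𝔼 n →L[ℝ] ℝ).smulRight (EuclideanSpace.single k (1 : ℝ)))

theorem christoffelMap_apply (x u v : 𝔼 n) (k : Fin n) :
    christoffelMap g x u v k = ∑ j, ∑ i, christoffel g k i j x * u i * v j := by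
  simp only [christoffelMap, _root_.sum_apply, _root_.smul_apply,
    ContinuousLinearMap.smulRight_apply, PiLp.proj_apply, WithLp.ofLp_sum, Finset.sum_apply,
    PiLp.smul_apply, PiLp.single_apply, smul_eq_mul]
  simp [mul_assoc]

variable {g}

theorem hasFDerivAt_christoffelMap_apply {x : 𝔼 n}
    (hg : ∀ k i j, DifferentiableAt ℝ (christoffel g k i j) x) (v w : 𝔼 n) (l : Fin n) :
    HasFDerivAt (fun y => christoffelMap g y v w l)
      (∑ k, ∑ j, w k • v j • fderiv ℝ (christoffel g l j k) x) x := by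
  simp only [christoffelMap_apply]
  exact HasFDerivAt.fun_sum fun k _ => HasFDerivAt.fun_sum fun j _ =>
    ((hg l j k).hasFDerivAt.mul_const _).mul_const _

theorem differentiableAt_christoffelMap {x : 𝔼 n}
    (hg : ∀ k i j, DifferentiableAt ℝ (christoffel g k i j) x) (v w : 𝔼 n) :
    DifferentiableAt ℝ (fun y => christoffelMap g y v w) x :=
  differentiableAt_euclidean.2 fun l =>
    (hasFDerivAt_christoffelMap_apply hg v w l).differentiableAt

theorem fderiv_christoffelMap_apply {x : 𝔼 n}
    (hg : ∀ k i j, DifferentiableAt ℝ (christoffel g k i j) x) (u v w : 𝔼 n) (l : Fin n) :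
    fderiv ℝ (fun y => christoffelMap g y v w) x u l =
      ∑ k, ∑ i, ∑ j, pderiv i (christoffel g l j k) x * u i * v j * w k := by
  have hcomp := (EuclideanSpace.proj l : 𝔼 n →L[ℝ] ℝ).hasFDerivAt.comp x
    (differentiableAt_christoffelMap hg v w).hasFDerivAt
  have hval := congrArg (fun L : 𝔼 n →L[ℝ] ℝ => L u)
    (hcomp.unique (hasFDerivAt_christoffelMap_apply hg v w l))
  simp only [_root_.sum_apply, ContinuousLinearMap.comp_apply, _root_.smul_apply] at hval
  refine hval.trans (Finset.sum_congr rfl fun k _ => ?_)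
  rw [Finset.sum_comm]
  refine Finset.sum_congr rfl fun j _ => ?_
  rw [clm_apply_eq_sum_single, Finset.smul_sum, Finset.smul_sum]
  refine Finset.sum_congr rfl fun i _ => ?_
  simp only [pderiv, smul_eq_mul]
  ring

theorem riemannVec_eq {x : 𝔼 n} (hg : ∀ k i j, DifferentiableAt ℝ (christoffel g k i j) x)
    (u v w : 𝔼 n) :
    riemannVec g x u v w =
      fderiv ℝ (fun y => christoffelMap g y v w) x u
        - fderiv ℝ (fun y => christoffelMap g y u w) x v
        + (christoffelMap g x u (christoffelMap g x v w)
          - christoffelMap g x v (christoffelMap g x u w)) := by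
  have hcomp : ∀ (u v : 𝔼 n) (l : Fin n), christoffelMap g x u (christoffelMap g x v w) l =
      ∑ k, ∑ i, ∑ j, (∑ m, christoffel g l i m x * christoffel g m j k x) * u i * v j * w k := by
    intro u v l
    simp only [christoffelMap_apply, Finset.mul_sum, Finset.sum_mul]
    refine Finset.sum_comm.trans ((Finset.sum_congr rfl fun i _ => Finset.sum_comm).trans ?_)
    refine Finset.sum_comm.trans (Finset.sum_congr rfl fun k _ => Finset.sum_congr rfl fun i _ =>
      Finset.sum_comm.trans ?_)
    exact Finset.sum_congr rfl fun j _ => Finset.sum_congr rfl fun m _ => by ring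
  have hswap : ∀ T : Fin n → Fin n → Fin n → ℝ, ∑ k, ∑ i, ∑ j, T i j k * v i * u j * w k =
      ∑ k, ∑ i, ∑ j, T j i k * u i * v j * w k := by
    intro T
    refine Finset.sum_congr rfl fun k _ => ?_
    rw [Finset.sum_comm]
    exact Finset.sum_congr rfl fun i _ => Finset.sum_congr rfl fun j _ => by ring
  ext l
  simp only [riemannVec, PiLp.add_apply, PiLp.sub_apply, fderiv_christoffelMap_apply hg, hcomp,
    hswap fun i j k => pderiv i (christoffel g l j k) x,
    hswap fun i j k => ∑ m, christoffel g l i m x * christoffel g m j k x,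
    ← Finset.sum_add_distrib, ← Finset.sum_sub_distrib]
  refine Finset.sum_congr rfl fun k _ => Finset.sum_congr rfl fun i _ =>
    Finset.sum_congr rfl fun j _ => ?_
  rw [riemann, Finset.sum_sub_distrib]
  ring

end Christoffel

/-! ## The Gauss equation for a metric frame -/

section MatrixSmooth

variable {E : Type*} [NormedAddCommGroup E] [NormedSpace ℝ E] {ι : Type*} [Fintype ι]
  [DecidableEq ι] {g : E → Matrix ι ι ℝ} {x : E}

theorem differentiableAt_det (hg : ∀ i j, DifferentiableAt ℝ (fun y => g y i j) x) :
    DifferentiableAt ℝ (fun y => (g y).det) x := by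
  simp only [Matrix.det_apply]
  refine .fun_sum fun σ _ => .const_smul ?_ _
  exact (HasFDerivAt.finsetProd fun i _ => (hg (σ i) i).hasFDerivAt).differentiableAt

theorem differentiableAt_inv (hg : ∀ i j, DifferentiableAt ℝ (fun y => g y i j) x)
    (hdet : (g x).det ≠ 0) (i j : ι) : DifferentiableAt ℝ (fun y => (g y)⁻¹ i j) x := by
  simp only [Matrix.inv_def, Ring.inverse_eq_inv', Matrix.smul_apply, smul_eq_mul,
    Matrix.adjugate_apply]
  refine ((differentiableAt_det hg).inv hdet).mul (differentiableAt_det fun a b => ?_)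
  simp only [Matrix.updateRow_apply]
  split_ifs
  · exact differentiableAt_const _
  · exact hg a b

end MatrixSmooth

section MetricFrame

variable {n : ℕ} {V : Type*} [NormedAddCommGroup V] [InnerProductSpace ℝ V]

/-- `X` is a smooth frame over the open set `U ⊆ ℝⁿ`, encoded as a family of injective linear maps
`X x : ℝⁿ → V`, whose Gram matrix is `g`, together with a metric connection `∇ = ∂ - A` on the
trivial bundle with fibre `V` that is torsion free in the directions of the frame. -/
structure IsMetricFrame (g : 𝔼 n → Matrix (Fin n) (Fin n) ℝ) (U : Set 𝔼 n)
    (A : 𝔼 n → 𝔼 n →L[ℝ] V →L[ℝ] V) (X : 𝔼 n → 𝔼 n →L[ℝ] V) : Prop where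
  isOpen : IsOpen U
  contDiffOn_conn : ContDiffOn ℝ ∞ A U
  contDiffOn_frame : ContDiffOn ℝ ∞ X U
  inner_conn_left : ∀ x ∈ U, ∀ u v w, inner ℝ (A x u v) w = -inner ℝ v (A x u w)
  injective : ∀ x ∈ U, Function.Injective (X x)
  metric_eq : ∀ x ∈ U, ∀ i j,
    g x i j = inner ℝ (X x (EuclideanSpace.single i 1)) (X x (EuclideanSpace.single j 1))
  torsion_free : ∀ x ∈ U, ∀ u v w, inner ℝ (covDeriv A (fun y => X y v) x u) (X x w) =
    inner ℝ (covDeriv A (fun y => X y u) x v) (X x w)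

/-- The second fundamental form `B(u, v) = ∇_u X(v) - X(Γ(u, v))` of the frame `X`, where `Γ` is
the Levi-Civita connection of `g`. -/
def secondForm (g : 𝔼 n → Matrix (Fin n) (Fin n) ℝ) (A : 𝔼 n → 𝔼 n →L[ℝ] V →L[ℝ] V)
    (X : 𝔼 n → 𝔼 n →L[ℝ] V) (x : 𝔼 n) : 𝔼 n →L[ℝ] 𝔼 n →L[ℝ] V :=
  fderiv ℝ X x - (ContinuousLinearMap.compL ℝ (𝔼 n) V V).flip (X x) ∘L A x -
    ContinuousLinearMap.compL ℝ (𝔼 n) (𝔼 n) V (X x) ∘L christoffelMap g x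

namespace IsMetricFrame

variable {g : 𝔼 n → Matrix (Fin n) (Fin n) ℝ} {U : Set 𝔼 n} {A : 𝔼 n → 𝔼 n →L[ℝ] V →L[ℝ] V}
  {X : 𝔼 n → 𝔼 n →L[ℝ] V} (h : IsMetricFrame g U A X) {x : 𝔼 n} (hx : x ∈ U)

include h hx

theorem contDiffAt_frame : ContDiffAt ℝ ∞ X x :=
  h.contDiffOn_frame.contDiffAt (h.isOpen.mem_nhds hx)

theorem differentiableAt_frame : DifferentiableAt ℝ X x :=
  (h.contDiffAt_frame hx).differentiableAt (by simp)

theorem differentiableAt_conn : DifferentiableAt ℝ A x :=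
  (h.contDiffOn_conn.contDiffAt (h.isOpen.mem_nhds hx)).differentiableAt (by simp)

theorem differentiableAt_frame_apply (v : 𝔼 n) : DifferentiableAt ℝ (fun y => X y v) x :=
  (h.differentiableAt_frame hx).clm_apply (differentiableAt_const v)

theorem differentiableAt_covDeriv (u v : 𝔼 n) :
    DifferentiableAt ℝ (fun y => covDeriv A (fun z => X z v) y u) x := by
  have hXv : ContDiffAt ℝ ∞ (fun y => X y v) x := (h.contDiffAt_frame hx).clm_apply contDiffAt_const
  have hXv' : DifferentiableAt ℝ (fderiv ℝ fun y => X y v) x :=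
    (hXv.fderiv_right (m := 1) (by norm_cast)).differentiableAt (by simp)
  exact (hXv'.clm_apply (differentiableAt_const u)).sub
    (((h.differentiableAt_conn hx).clm_apply (differentiableAt_const u)).clm_apply
      (h.differentiableAt_frame_apply hx v))

theorem secondForm_apply (u v : 𝔼 n) :
    secondForm g A X x u v = covDeriv A (fun y => X y v) x u - X x (christoffelMap g x u v) := by
  rw [covDeriv, fderiv_clm_apply (h.differentiableAt_frame hx) (differentiableAt_const v)]
  simp [secondForm]

theorem metricForm_eq (u v : 𝔼 n) : metricForm g x u v = inner ℝ (X x u) (X x v) := by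
  rw [clm_apply_eq_sum_single (X x) u, clm_apply_eq_sum_single (X x) v]
  simp only [metricForm, h.metric_eq x hx, sum_inner]
  refine Finset.sum_congr rfl fun i _ => ?_
  rw [inner_sum]
  refine Finset.sum_congr rfl fun j _ => ?_
  rw [real_inner_smul_left, real_inner_smul_right]
  ring

theorem det_metric_ne_zero : (g x).det ≠ 0 := by
  intro hdet
  obtain ⟨v, hv, hgv⟩ := Matrix.exists_mulVec_eq_zero_iff.2 hdet
  have hXv : X x (WithLp.toLp 2 v) = 0 := by
    rw [← inner_self_eq_zero (𝕜 := ℝ), ← h.metricForm_eq hx]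
    refine Finset.sum_eq_zero fun i _ => ?_
    have hi := congrFun hgv i
    rw [Matrix.mulVec, dotProduct, Pi.zero_apply] at hi
    simp only [mul_right_comm _ (v i), ← Finset.sum_mul, hi, zero_mul]
  exact hv ((WithLp.toLp_eq_zero 2).1 (h.injective x hx (hXv.trans (map_zero _).symm)))

theorem metric_eventuallyEq (i j : Fin n) : (fun y => g y i j) =ᶠ[𝓝 x]
    fun y => inner ℝ (X y (EuclideanSpace.single i 1)) (X y (EuclideanSpace.single j 1)) := by
  filter_upwards [h.isOpen.mem_nhds hx] with y hy using h.metric_eq y hy i j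

theorem differentiableAt_metric (i j : Fin n) : DifferentiableAt ℝ (fun y => g y i j) x :=
  ((h.differentiableAt_frame_apply hx _).inner ℝ
    (h.differentiableAt_frame_apply hx _)).congr_of_eventuallyEq (h.metric_eventuallyEq hx i j)

theorem pderiv_metric (l i j : Fin n) : pderiv l (fun y => g y i j) x =
    inner ℝ (covDeriv A (fun y => X y (EuclideanSpace.single i 1)) x (EuclideanSpace.single l 1))
        (X x (EuclideanSpace.single j 1))
      + inner ℝ (covDeriv A (fun y => X y (EuclideanSpace.single j 1)) x
        (EuclideanSpace.single l 1)) (X x (EuclideanSpace.single i 1)) := by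
  rw [pderiv, (h.metric_eventuallyEq hx i j).fderiv_eq,
    fderiv_inner_eq_covDeriv (h.inner_conn_left x hx _) (h.differentiableAt_frame_apply hx _)
      (h.differentiableAt_frame_apply hx _), real_inner_comm (covDeriv _ _ _ _)]

theorem christoffel_eq (k i j : Fin n) : christoffel g k i j x =
    ∑ l, (g x)⁻¹ k l * inner ℝ (covDeriv A (fun y => X y (EuclideanSpace.single j 1)) x
      (EuclideanSpace.single i 1)) (X x (EuclideanSpace.single l 1)) := by
  rw [christoffel, Finset.mul_sum]
  refine Finset.sum_congr rfl fun l _ => ?_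
  rw [h.pderiv_metric hx, h.pderiv_metric hx, h.pderiv_metric hx,
    h.torsion_free x hx (EuclideanSpace.single j 1) (EuclideanSpace.single i 1),
    h.torsion_free x hx (EuclideanSpace.single j 1) (EuclideanSpace.single l 1),
    h.torsion_free x hx (EuclideanSpace.single l 1) (EuclideanSpace.single i 1)]
  ring

theorem differentiableAt_christoffel (k i j : Fin n) :
    DifferentiableAt ℝ (christoffel g k i j) x := by
  have hsum := DifferentiableAt.fun_sum (u := Finset.univ) fun (l : Fin n) _ =>
    (differentiableAt_inv (h.differentiableAt_metric hx) (h.det_metric_ne_zero hx) k l).mul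
      ((h.differentiableAt_covDeriv hx (EuclideanSpace.single i 1)
        (EuclideanSpace.single j 1)).inner ℝ
          (h.differentiableAt_frame_apply hx (EuclideanSpace.single l 1)))
  refine hsum.congr_of_eventuallyEq ?_
  filter_upwards [h.isOpen.mem_nhds hx] with y hy using h.christoffel_eq hy k i j

theorem inner_secondForm_single (i j l : Fin n) :
    inner ℝ (secondForm g A X x (EuclideanSpace.single i 1) (EuclideanSpace.single j 1))
      (X x (EuclideanSpace.single l 1)) = 0 := by
  set f : Fin n → ℝ := fun m => inner ℝ (covDeriv A (fun y => X y (EuclideanSpace.single j 1)) x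
    (EuclideanSpace.single i 1)) (X x (EuclideanSpace.single m 1)) with hf
  have hΓ : ∀ k, christoffelMap g x (EuclideanSpace.single i 1) (EuclideanSpace.single j 1) k =
      ((g x)⁻¹ *ᵥ f) k := fun k => by
    simp [christoffelMap_apply, PiLp.single_apply, h.christoffel_eq hx, Matrix.mulVec, dotProduct,
      hf]
  have hgf : (g x *ᵥ ((g x)⁻¹ *ᵥ f)) l = f l := by
    rw [Matrix.mulVec_mulVec, Matrix.mul_nonsing_inv _ (h.det_metric_ne_zero hx).isUnit,
      Matrix.one_mulVec]
  rw [h.secondForm_apply hx, inner_sub_left, sub_eq_zero,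
    real_inner_comm (X x (EuclideanSpace.single l 1)) (X x _), ← h.metricForm_eq hx]
  change f l = _
  rw [← hgf]
  simp [metricForm, hΓ, Matrix.mulVec, dotProduct, PiLp.single_apply]

theorem inner_secondForm (u v w : 𝔼 n) : inner ℝ (secondForm g A X x u v) (X x w) = 0 := by
  rw [clm_apply_eq_sum_single (secondForm g A X x), clm_apply_eq_sum_single (X x), _root_.sum_apply,
    sum_inner]
  refine Finset.sum_eq_zero fun i _ => ?_
  rw [_root_.smul_apply, clm_apply_eq_sum_single (secondForm g A X x _)]
  simp [sum_inner, inner_sum, inner_smul_left, inner_smul_right, h.inner_secondForm_single hx]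

theorem inner_frame_christoffelMap (u v w : 𝔼 n) :
    inner ℝ (X x (christoffelMap g x u v)) (X x w) =
      inner ℝ (covDeriv A (fun y => X y v) x u) (X x w) := by
  have horth := h.inner_secondForm hx u v w
  rw [h.secondForm_apply hx, inner_sub_left, sub_eq_zero] at horth
  exact horth.symm

theorem christoffelMap_comm (u v : 𝔼 n) : christoffelMap g x u v = christoffelMap g x v u := by
  have hinner : inner ℝ (X x (christoffelMap g x u v) - X x (christoffelMap g x v u))
      (X x (christoffelMap g x u v - christoffelMap g x v u)) = 0 := by
    rw [inner_sub_left, h.inner_frame_christoffelMap hx, h.inner_frame_christoffelMap hx,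
      h.torsion_free x hx, sub_self]
  rw [← map_sub, inner_self_eq_zero] at hinner
  exact sub_eq_zero.1 ((map_eq_zero_iff _ (h.injective x hx)).1 hinner)

/-- The derivative along `u` of the identity `⟪X Γ(v, w), X z⟫ = ⟪∇_v X(w), X z⟫`. -/
theorem inner_frame_fderiv_christoffelMap (u v w z : 𝔼 n) :
    inner ℝ (X x (fderiv ℝ (fun y => christoffelMap g y v w) x u
        + christoffelMap g x u (christoffelMap g x v w))) (X x z) =
      inner ℝ (covDeriv A (fun y => covDeriv A (fun t => X t w) y v) x u) (X x z)
        + inner ℝ (secondForm g A X x v w) (secondForm g A X x u z) := by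
  have hΓ : DifferentiableAt ℝ (fun y => christoffelMap g y v w) x :=
    differentiableAt_christoffelMap (h.differentiableAt_christoffel hx) v w
  have hXz := h.differentiableAt_frame_apply hx z
  have hnear : (fun y => inner ℝ (X y (christoffelMap g y v w)) (X y z)) =ᶠ[𝓝 x]
      fun y => inner ℝ (covDeriv A (fun t => X t w) y v) (X y z) := by
    filter_upwards [h.isOpen.mem_nhds hx] with y hy using h.inner_frame_christoffelMap hy v w z
  have hderiv := congrArg (fun L : 𝔼 n →L[ℝ] ℝ => L u) hnear.fderiv_eq
  rw [fderiv_inner_eq_covDeriv (h.inner_conn_left x hx u)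
      ((h.differentiableAt_frame hx).clm_apply hΓ) hXz,
    fderiv_inner_eq_covDeriv (h.inner_conn_left x hx u) (h.differentiableAt_covDeriv hx v w) hXz,
    covDeriv_clm_apply (h.differentiableAt_frame hx) hΓ] at hderiv
  have hframe := covDeriv_clm_apply (A := A) (h.differentiableAt_frame hx)
    (differentiableAt_const (christoffelMap g x v w)) u
  rw [fderiv_fun_const, Pi.zero_apply, _root_.zero_apply, map_zero, zero_add] at hframe
  have hB : inner ℝ (secondForm g A X x v w) (covDeriv A (fun y => X y z) x u) =
      inner ℝ (secondForm g A X x v w) (secondForm g A X x u z) := by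
    rw [h.secondForm_apply hx u z, inner_sub_right _ (covDeriv _ _ _ _), h.inner_secondForm hx,
      sub_zero]
  rw [h.secondForm_apply hx v w, inner_sub_left, ← h.secondForm_apply hx v w] at hB
  rw [← hframe, inner_add_left, ← h.inner_frame_christoffelMap hx] at hderiv
  rw [map_add, inner_add_left]
  linarith

/-- The Gauss equation: `[∇_u, ∇_v] = -F(u, v)` contributes the first term. -/
theorem metricForm_riemannVec (u v w z : 𝔼 n) :
    metricForm g x (riemannVec g x u v w) z =
      -inner ℝ (connCurvature A x u v (X x w)) (X x z)
        + inner ℝ (secondForm g A X x v w) (secondForm g A X x u z)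
        - inner ℝ (secondForm g A X x u w) (secondForm g A X x v z) := by
  have hXw : ContDiffAt ℝ 2 (fun y => X y w) x :=
    ((h.contDiffAt_frame hx).clm_apply contDiffAt_const).of_le (by norm_cast)
  have hcomm := congrArg (fun v => inner ℝ v (X x z))
    (covDeriv_comm (h.differentiableAt_conn hx) hXw u v)
  have huv := h.inner_frame_fderiv_christoffelMap hx u v w z
  have hvu := h.inner_frame_fderiv_christoffelMap hx v u w z
  rw [h.metricForm_eq hx, riemannVec_eq (h.differentiableAt_christoffel hx)]
  simp only [map_add, map_sub, inner_add_left, inner_sub_left, inner_neg_left] at hcomm huv hvu ⊢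
  linarith

end IsMetricFrame

end MetricFrame

/-! ## Bounds for the sectional curvature of a metric frame -/

section CurvatureBound

variable {V : Type*} [NormedAddCommGroup V] [InnerProductSpace ℝ V]

section GaussForm

variable {E : Type*} [NormedAddCommGroup E] [NormedSpace ℝ E]

/-- The numerator of the sectional curvature of the plane spanned by `u` and `v`, as the Gauss
equation expresses it by a curvature form `F`, a second fundamental form `B` and a frame `X`. -/
def gaussForm (F : E →L[ℝ] E →L[ℝ] V →L[ℝ] V) (B : E →L[ℝ] E →L[ℝ] V) (X : E →L[ℝ] V)
    (u v : E) : ℝ :=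
  -inner ℝ (F u v (X v)) (X u) + inner ℝ (B v v) (B u u) - inner ℝ (B u v) (B v u)

variable {F : E →L[ℝ] E →L[ℝ] V →L[ℝ] V} {B : E →L[ℝ] E →L[ℝ] V} {X : E →L[ℝ] V}

theorem gaussForm_add_smul_self (hF_self : ∀ u, F u u = 0)
    (hF_skew : ∀ u v a b, inner ℝ (F u v a) b = -inner ℝ a (F u v b)) (u w : E) (t : ℝ) :
    gaussForm F B X u (w + t • u) = gaussForm F B X u w := by
  have hFw : inner ℝ (F u w (X u)) (X u) = 0 :=
    self_eq_neg.1 ((hF_skew u w _ _).trans (by rw [real_inner_comm]))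
  simp only [gaussForm, map_add, map_smul, hF_self, smul_zero, add_zero, _root_.add_apply,
    _root_.smul_apply, inner_add_left, inner_add_right, real_inner_smul_left,
    real_inner_smul_right, hFw, real_inner_comm (B u u)]
  ring

theorem abs_gaussForm_le {a b : ℝ} (hF : ∀ u v, ‖F u v‖ ≤ a * (‖X u‖ * ‖X v‖))
    (hB : ∀ u v, ‖B u v‖ ≤ b * (‖X u‖ * ‖X v‖)) (u v : E) :
    |gaussForm F B X u v| ≤ (a + 2 * b ^ 2) * (‖X u‖ ^ 2 * ‖X v‖ ^ 2) := by
  have hF_inner : |inner ℝ (F u v (X v)) (X u)| ≤ a * (‖X u‖ ^ 2 * ‖X v‖ ^ 2) := calc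
    |inner ℝ (F u v (X v)) (X u)| ≤ ‖F u v‖ * ‖X v‖ * ‖X u‖ :=
      (abs_real_inner_le_norm _ _).trans (by gcongr; exact (F u v).le_opNorm _)
    _ ≤ a * (‖X u‖ * ‖X v‖) * ‖X v‖ * ‖X u‖ := by gcongr; exact hF u v
    _ = a * (‖X u‖ ^ 2 * ‖X v‖ ^ 2) := by ring
  have hB_inner (p q r s : E) : |inner ℝ (B p q) (B r s)| ≤
      b ^ 2 * (‖X p‖ * ‖X q‖ * (‖X r‖ * ‖X s‖)) := calc
    |inner ℝ (B p q) (B r s)| ≤ ‖B p q‖ * ‖B r s‖ := abs_real_inner_le_norm _ _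
    _ ≤ b * (‖X p‖ * ‖X q‖) * (b * (‖X r‖ * ‖X s‖)) :=
      mul_le_mul (hB p q) (hB r s) (norm_nonneg _) ((norm_nonneg _).trans (hB p q))
    _ = b ^ 2 * (‖X p‖ * ‖X q‖ * (‖X r‖ * ‖X s‖)) := by ring
  calc |gaussForm F B X u v|
      ≤ |inner ℝ (F u v (X v)) (X u)| + |inner ℝ (B v v) (B u u)| + |inner ℝ (B u v) (B v u)| := by
        rw [gaussForm, ← abs_neg (inner ℝ (F u v (X v)) (X u))]
        exact (abs_sub _ _).trans (by gcongr; exact abs_add_le _ _)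
    _ ≤ a * (‖X u‖ ^ 2 * ‖X v‖ ^ 2) + b ^ 2 * (‖X v‖ * ‖X v‖ * (‖X u‖ * ‖X u‖)) +
        b ^ 2 * (‖X u‖ * ‖X v‖ * (‖X v‖ * ‖X u‖)) :=
      add_le_add_three hF_inner (hB_inner v v u u) (hB_inner u v v u)
    _ = (a + 2 * b ^ 2) * (‖X u‖ ^ 2 * ‖X v‖ ^ 2) := by ring

theorem exists_eq_add_smul_of_inner_eq_zero {u : E} (hu : X u ≠ 0) (v : E) :
    ∃ (w : E) (t : ℝ), v = w + t • u ∧ inner ℝ (X u) (X w) = 0 := by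
  refine ⟨v - (inner ℝ (X u) (X v) / inner ℝ (X u) (X u)) • u, _, (sub_add_cancel v _).symm, ?_⟩
  rw [map_sub, map_smul, inner_sub_right, real_inner_smul_right,
    div_mul_cancel₀ _ (inner_self_ne_zero.2 hu), sub_self]

/-- Both the numerator and the Gram determinant are invariant under `v ↦ v + t u`, so `u` and `v`
may be assumed orthogonal. -/
theorem abs_gaussForm_div_le (hX : Function.Injective X) (hF_self : ∀ u, F u u = 0)
    (hF_skew : ∀ u v a b, inner ℝ (F u v a) b = -inner ℝ a (F u v b)) {a b : ℝ}
    (hF : ∀ u v, ‖F u v‖ ≤ a * (‖X u‖ * ‖X v‖)) (hB : ∀ u v, ‖B u v‖ ≤ b * (‖X u‖ * ‖X v‖))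
    {u v : E} (huv : LinearIndependent ℝ ![u, v]) :
    |gaussForm F B X u v / (inner ℝ (X u) (X u) * inner ℝ (X v) (X v) - inner ℝ (X u) (X v) ^ 2)|
      ≤ a + 2 * b ^ 2 := by
  have hXu : X u ≠ 0 := (map_ne_zero_iff X hX).2 (huv.ne_zero 0)
  obtain ⟨w, t, rfl, horth⟩ := exists_eq_add_smul_of_inner_eq_zero hXu v
  have hXw : X w ≠ 0 := (map_ne_zero_iff X hX).2 fun hw => by
    simpa [hw] using LinearIndependent.pair_iff.1 huv t (-1)
  have hgram : inner ℝ (X u) (X u) * inner ℝ (X (w + t • u)) (X (w + t • u))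
      - inner ℝ (X u) (X (w + t • u)) ^ 2 = ‖X u‖ ^ 2 * ‖X w‖ ^ 2 := by
    simp only [map_add, map_smul, inner_add_left, inner_add_right, real_inner_smul_left,
      real_inner_smul_right, real_inner_comm (X u) (X w), horth, ← real_inner_self_eq_norm_sq]
    ring
  have hpos : 0 < ‖X u‖ ^ 2 * ‖X w‖ ^ 2 := by positivity
  rw [gaussForm_add_smul_self hF_self hF_skew, hgram, abs_div, abs_of_pos hpos, div_le_iff₀ hpos]
  exact abs_gaussForm_le hF hB u w

end GaussForm

namespace IsMetricFrame

variable {n : ℕ} {g : 𝔼 n → Matrix (Fin n) (Fin n) ℝ} {U : Set 𝔼 n}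
  {A : 𝔼 n → 𝔼 n →L[ℝ] V →L[ℝ] V} {X : 𝔼 n → 𝔼 n →L[ℝ] V} (h : IsMetricFrame g U A X) {x : 𝔼 n}
  (hx : x ∈ U)

include h hx

theorem inner_fderiv_conn_left (u v : 𝔼 n) (a b : V) :
    inner ℝ (fderiv ℝ A x u v a) b = -inner ℝ a (fderiv ℝ A x u v b) := by
  have hA (c : V) : HasFDerivAt (fun y => A y v c) _ x :=
    ((h.differentiableAt_conn hx).hasFDerivAt.clm_apply (hasFDerivAt_const v x)).clm_apply
      (hasFDerivAt_const c x)
  have hskew : (fun y => inner ℝ (A y v a) b) =ᶠ[𝓝 x] fun y => -inner ℝ a (A y v b) := by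
    filter_upwards [h.isOpen.mem_nhds hx] with y hy using h.inner_conn_left y hy v a b
  have hderiv := congrArg (fun L : 𝔼 n →L[ℝ] ℝ => L u) hskew.fderiv_eq
  rw [((hA a).inner ℝ (hasFDerivAt_const b x)).fderiv,
    ((hasFDerivAt_const a x).inner ℝ (hA b)).fun_neg.fderiv] at hderiv
  simpa using hderiv

theorem inner_connCurvature_left (u v : 𝔼 n) (a b : V) :
    inner ℝ (connCurvature A x u v a) b = -inner ℝ a (connCurvature A x u v b) := by
  simp only [connCurvature_apply, _root_.sub_apply, mul_apply_eq_comp, inner_sub_left,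
    inner_sub_right, h.inner_fderiv_conn_left hx, h.inner_conn_left x hx]
  ring

theorem sectionalCurvature_eq (u v : 𝔼 n) : sectionalCurvature g x u v =
    gaussForm (connCurvature A x) (secondForm g A X x) (X x) u v /
      (inner ℝ (X x u) (X x u) * inner ℝ (X x v) (X x v) - inner ℝ (X x u) (X x v) ^ 2) := by
  simp only [sectionalCurvature, h.metricForm_riemannVec hx, h.metricForm_eq hx, gaussForm]

theorem abs_sectionalCurvature_le {a b : ℝ}
    (hF : ∀ u v, ‖connCurvature A x u v‖ ≤ a * (‖X x u‖ * ‖X x v‖))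
    (hB : ∀ u v, ‖secondForm g A X x u v‖ ≤ b * (‖X x u‖ * ‖X x v‖)) {u v : 𝔼 n}
    (huv : LinearIndependent ℝ ![u, v]) : |sectionalCurvature g x u v| ≤ a + 2 * b ^ 2 := by
  rw [h.sectionalCurvature_eq hx]
  exact abs_gaussForm_div_le (h.injective x hx) (connCurvature_self A x)
    (h.inner_connCurvature_left hx) hF hB huv

end IsMetricFrame

end CurvatureBound

/-! ## Coordinates on a space of operators -/

section Coordinates

variable {V : Type*} [NormedAddCommGroup V] [NormedSpace ℝ V] [FiniteDimensional ℝ V]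
  (𝔥 : Submodule ℝ (V →L[ℝ] V))

/-- A linear parametrization of a space of operators by `ℝᵐ`. -/
def coordMap : (Fin (Module.finrank ℝ 𝔥) → ℝ) →L[ℝ] V →L[ℝ] V :=
  LinearMap.toContinuousLinearMap
    (𝔥.subtype ∘ₗ (Module.finBasis ℝ 𝔥).equivFun.symm.toLinearMap)

theorem coordMap_mem (a : Fin (Module.finrank ℝ 𝔥) → ℝ) : coordMap 𝔥 a ∈ 𝔥 :=
  ((Module.finBasis ℝ 𝔥).equivFun.symm a).2

theorem coordMap_injective : Function.Injective (coordMap 𝔥) := fun _ _ h =>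
  (Module.finBasis ℝ 𝔥).equivFun.symm.injective (Subtype.ext h)

theorem exists_coordMap_eq {T : V →L[ℝ] V} (hT : T ∈ 𝔥) : ∃ a, coordMap 𝔥 a = T :=
  ⟨(Module.finBasis ℝ 𝔥).equivFun ⟨T, hT⟩, congrArg Subtype.val
    ((Module.finBasis ℝ 𝔥).equivFun.symm_apply_apply ⟨T, hT⟩)⟩

end Coordinates

section Slice

/-! ## The vertical part of a vector -/

variable {V : Type*} [NormedAddCommGroup V] [InnerProductSpace ℝ V]

section VerticalPart

variable {H : Type*} [NormedAddCommGroup H] [NormedSpace ℝ H] (ι : H →L[ℝ] V →L[ℝ] V)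

/-- The functional `T ↦ ⟪w, T q⟫` on the space `H` of operators, as a linear function of `w`. -/
def pairing (q : V) : V →L[ℝ] H →L[ℝ] ℝ :=
  (ContinuousLinearMap.compL ℝ H V ℝ).flip (ι.flip q) ∘L (innerSL ℝ : V →L[ℝ] V →L[ℝ] ℝ)

/-- The Gram form `⟪S q, T q⟫` of the infinitesimal action of `H` at `q`. -/
def gram (q : V) : H →L[ℝ] H →L[ℝ] ℝ := pairing ι q ∘L ι.flip q

/-- The element of `H` whose value at `q` is the orthogonal projection of `w` to the tangent space
`H q` of the orbit. Meaningful only where the infinitesimal action is injective: elsewhere the Gram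
form is not invertible, and `ContinuousLinearMap.inverse` returns `0`. -/
def vertPart (q : V) : V →L[ℝ] H := (gram ι q).inverse ∘L pairing ι q

theorem contDiff_pairing : ContDiff ℝ ∞ (pairing ι) :=
  ((ContinuousLinearMap.contDiff _).comp ι.flip.contDiff).clm_comp contDiff_const

theorem contDiff_gram : ContDiff ℝ ∞ (gram ι) :=
  (contDiff_pairing ι).clm_comp ι.flip.contDiff

variable {ι} [FiniteDimensional ℝ H]

theorem exists_continuousLinearEquiv_eq_gram {q : V} (hq : Function.Injective (ι.flip q)) :
    ∃ e : H ≃L[ℝ] (H →L[ℝ] ℝ), (e : H →L[ℝ] H →L[ℝ] ℝ) = gram ι q := by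
  have hinj : Function.Injective (gram ι q : H →ₗ[ℝ] H →L[ℝ] ℝ) :=
    (injective_iff_map_eq_zero _).2 fun T hT => (injective_iff_map_eq_zero _).1 hq T
      (inner_self_eq_zero (𝕜 := ℝ).1 (congrArg (fun L : H →L[ℝ] ℝ => L T) hT))
  have hdim : Module.finrank ℝ H = Module.finrank ℝ (H →L[ℝ] ℝ) := by
    rw [← (LinearMap.toContinuousLinearMap (𝕜 := ℝ) (E := H) (F' := ℝ)).finrank_eq]
    exact (Subspace.dual_finrank_eq (K := ℝ) (V := H)).symm
  exact ⟨(LinearEquiv.ofInjectiveOfFinrankEq _ hinj hdim).toContinuousLinearEquiv, rfl⟩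

theorem inner_vertPart {q : V} (hq : Function.Injective (ι.flip q)) (w : V) (T : H) :
    inner ℝ (ι (vertPart ι q w) q) (ι T q) = inner ℝ w (ι T q) := by
  obtain ⟨e, he⟩ := exists_continuousLinearEquiv_eq_gram hq
  have hgram : gram ι q (vertPart ι q w) = pairing ι q w := by
    rw [vertPart, ← he, ContinuousLinearMap.inverse_equiv]
    exact e.apply_symm_apply _
  exact congrArg (fun L : H →L[ℝ] ℝ => L T) hgram

theorem contDiffAt_vertPart {q : V} (hq : Function.Injective (ι.flip q)) :
    ContDiffAt ℝ ∞ (vertPart ι) q := by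
  have : CompleteSpace H := FiniteDimensional.complete ℝ H
  obtain ⟨e, he⟩ := exists_continuousLinearEquiv_eq_gram hq
  have hinverse : ContDiffAt ℝ ∞ ContinuousLinearMap.inverse (gram ι q) := by
    rw [← he]
    exact contDiffAt_map_inverse e
  exact (hinverse.comp q (contDiff_gram ι).contDiffAt).clm_comp (contDiff_pairing ι).contDiffAt

end VerticalPart

/-! ## The horizontal frame of a slice -/

/-- A Lie algebra `𝔥` of skew operators commuting with the isometries `J 0 = 1, J 1, J 2, J 3`,
which multiply like the units of the quaternions. -/
structure IsQuaternionic (𝔥 : Submodule ℝ (V →L[ℝ] V)) (J : Fin 4 → V →L[ℝ] V) : Prop where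
  inner_apply_left : ∀ T ∈ 𝔥, ∀ v w, inner ℝ (T v) w = -inner ℝ v (T w)
  mul_sub_mul_mem : ∀ T ∈ 𝔥, ∀ T' ∈ 𝔥, T * T' - T' * T ∈ 𝔥
  unit_zero : J 0 = 1
  unit_comm : ∀ T ∈ 𝔥, ∀ l v, J l (T v) = T (J l v)
  norm_unit : ∀ l v, ‖J l v‖ = ‖v‖
  inner_unit_left : ∀ l, l ≠ 0 → ∀ v w, inner ℝ (J l v) w = -inner ℝ v (J l w)
  inner_unit_unit : ∀ a b, a ≠ b → ∃ c, c ≠ 0 ∧ ∃ ε : ℝ, ∀ v w,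
    inner ℝ (J a v) (J b w) = ε * inner ℝ v (J c w)

/-- The infinitesimal action is free at `q`, and the images of the tangent space `𝔥 q` of the orbit
under the `J l` are mutually orthogonal. -/
structure IsRegularPoint (𝔥 : Submodule ℝ (V →L[ℝ] V)) (J : Fin 4 → V →L[ℝ] V) (q : V) : Prop where
  eq_zero_of_apply_eq_zero : ∀ T ∈ 𝔥, T q = 0 → T = 0
  inner_unit_apply : ∀ a b, a ≠ b → ∀ T ∈ 𝔥, ∀ T' ∈ 𝔥, inner ℝ (J a (T q)) (J b (T' q)) = 0

/-- A smooth slice for the infinitesimal action of `𝔥`, tangent to a level set of the moment map: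
the differential of the `l`-th component of the moment map at `q` is `v ↦ ⟪v, J l (T q)⟫`, up to a
factor, when paired with `T`. -/
structure IsSlice (𝔥 : Submodule ℝ (V →L[ℝ] V)) (J : Fin 4 → V →L[ℝ] V) {n : ℕ}
    (U : Set 𝔼 n) (s : 𝔼 n → V) : Prop where
  isOpen : IsOpen U
  contDiffOn : ContDiffOn ℝ ∞ s U
  isRegularPoint : ∀ x ∈ U, IsRegularPoint 𝔥 J (s x)
  inner_fderiv_unit : ∀ x ∈ U, ∀ u, ∀ l, l ≠ 0 → ∀ T ∈ 𝔥,
    inner ℝ (fderiv ℝ s x u) (J l (T (s x))) = 0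
  transverse : ∀ x ∈ U, ∀ u, ∀ T ∈ 𝔥, fderiv ℝ s x u = T (s x) → u = 0
  finrank_eq : n + 4 * Module.finrank ℝ 𝔥 = Module.finrank ℝ V

variable [FiniteDimensional ℝ V] (𝔥 : Submodule ℝ (V →L[ℝ] V)) {n : ℕ}

/-- The connection form of the slice `s`: `A(u)` is the element of `𝔥` whose value at `s x` is the
vertical part of `∂_u s`. -/
def conn (s : 𝔼 n → V) (x : 𝔼 n) : 𝔼 n →L[ℝ] V →L[ℝ] V :=
  coordMap 𝔥 ∘L vertPart (coordMap 𝔥) (s x) ∘L fderiv ℝ s x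

/-- The horizontal frame of the slice `s`: the horizontal part `∇_u s = ∂_u s - A(u) s` of `∂_u s`,
as a linear function of `u`. -/
def horizontalFrame (s : 𝔼 n → V) (x : 𝔼 n) : 𝔼 n →L[ℝ] V :=
  fderiv ℝ s x - (conn 𝔥 s x).flip (s x)

variable {𝔥}

theorem conn_mem (s : 𝔼 n → V) (x u : 𝔼 n) : conn 𝔥 s x u ∈ 𝔥 :=
  coordMap_mem _ _

theorem horizontalFrame_apply (s : 𝔼 n → V) (x u : 𝔼 n) :
    horizontalFrame 𝔥 s x u = covDeriv (conn 𝔥 s) s x u :=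
  rfl

theorem IsRegularPoint.injective_coordMap_flip {J : Fin 4 → V →L[ℝ] V} {q : V}
    (hq : IsRegularPoint 𝔥 J q) : Function.Injective ((coordMap 𝔥).flip q) :=
  (injective_iff_map_eq_zero _).2 fun a ha => (map_eq_zero_iff _ (coordMap_injective 𝔥)).1
    (hq.eq_zero_of_apply_eq_zero _ (coordMap_mem 𝔥 a) ha)

namespace IsSlice

variable {J : Fin 4 → V →L[ℝ] V} {U : Set 𝔼 n} {s : 𝔼 n → V} (h : IsSlice 𝔥 J U s) {x : 𝔼 n}
  (hx : x ∈ U)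

include h hx

omit [FiniteDimensional ℝ V] in
theorem contDiffAt : ContDiffAt ℝ ∞ s x := h.contDiffOn.contDiffAt (h.isOpen.mem_nhds hx)

omit [FiniteDimensional ℝ V] in
theorem differentiableAt : DifferentiableAt ℝ s x := (h.contDiffAt hx).differentiableAt (by simp)

theorem injective_horizontalFrame : Function.Injective (horizontalFrame 𝔥 s x) :=
  (injective_iff_map_eq_zero _).2 fun u hu =>
    h.transverse x hx u _ (conn_mem s x u) (sub_eq_zero.1 hu)

theorem contDiffAt_vertPart_fderiv :
    ContDiffAt ℝ ∞ (fun y => vertPart (coordMap 𝔥) (s y) ∘L fderiv ℝ s y) x :=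
  ((contDiffAt_vertPart (h.isRegularPoint x hx).injective_coordMap_flip).comp x
    (h.contDiffAt hx)).clm_comp ((h.contDiffAt hx).fderiv_right (by norm_cast))

theorem contDiffAt_conn : ContDiffAt ℝ ∞ (conn 𝔥 s) x :=
  contDiffAt_const.clm_comp (h.contDiffAt_vertPart_fderiv hx)

theorem contDiffAt_horizontalFrame : ContDiffAt ℝ ∞ (horizontalFrame 𝔥 s) x :=
  ((h.contDiffAt hx).fderiv_right (by norm_cast)).sub
    (((coordMap 𝔥).flip.contDiff.contDiffAt.comp x (h.contDiffAt hx)).clm_comp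
      (h.contDiffAt_vertPart_fderiv hx))

/-- The derivatives of `A` stay in `𝔥` because `A` factors through the subspace `𝔥`. -/
theorem fderiv_conn_mem (u v : 𝔼 n) : fderiv ℝ (conn 𝔥 s) x u v ∈ 𝔥 := by
  have hfactor := (coordMap 𝔥).hasFDerivAt.comp x
    (((h.contDiffAt_vertPart_fderiv hx).differentiableAt (by simp)).hasFDerivAt.clm_apply
      (hasFDerivAt_const v x))
  have hconn := ((h.contDiffAt_conn hx).differentiableAt (by simp)).hasFDerivAt.clm_apply
    (hasFDerivAt_const v x)
  have hderiv := congrArg (fun L : 𝔼 n →L[ℝ] V →L[ℝ] V => L u) (hconn.unique hfactor)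
  simp only [ContinuousLinearMap.comp_zero, zero_add, ContinuousLinearMap.flip_apply] at hderiv
  rw [hderiv]
  exact coordMap_mem 𝔥 _

theorem connCurvature_mem (hJ : IsQuaternionic 𝔥 J) (u v : 𝔼 n) :
    connCurvature (conn 𝔥 s) x u v ∈ 𝔥 := by
  rw [connCurvature_apply]
  exact 𝔥.sub_mem (𝔥.sub_mem (h.fderiv_conn_mem hx u v) (h.fderiv_conn_mem hx v u))
    (hJ.mul_sub_mul_mem _ (conn_mem s x u) _ (conn_mem s x v))

theorem inner_horizontalFrame_unit (hJ : IsQuaternionic 𝔥 J) (u : 𝔼 n) (l : Fin 4)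
    {T : V →L[ℝ] V} (hT : T ∈ 𝔥) : inner ℝ (horizontalFrame 𝔥 s x u) (J l (T (s x))) = 0 := by
  have hq := h.isRegularPoint x hx
  rw [horizontalFrame_apply, covDeriv, inner_sub_left]
  rcases eq_or_ne l 0 with rfl | hl
  · obtain ⟨a, rfl⟩ := exists_coordMap_eq 𝔥 hT
    rw [hJ.unit_zero, sub_eq_zero]
    exact (inner_vertPart hq.injective_coordMap_flip _ a).symm
  · have horth := hq.inner_unit_apply 0 l hl.symm _ (conn_mem s x u) T hT
    rw [hJ.unit_zero] at horth
    rw [h.inner_fderiv_unit x hx u l hl T hT, zero_sub, neg_eq_zero]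
    exact horth

theorem inner_horizontalFrame_apply (hJ : IsQuaternionic 𝔥 J) (u : 𝔼 n) {T : V →L[ℝ] V}
    (hT : T ∈ 𝔥) : inner ℝ (horizontalFrame 𝔥 s x u) (T (s x)) = 0 := by
  simpa [hJ.unit_zero] using h.inner_horizontalFrame_unit hx hJ u 0 hT

theorem covDeriv_horizontalFrame_sub (u v : 𝔼 n) :
    covDeriv (conn 𝔥 s) (fun y => horizontalFrame 𝔥 s y v) x u
        - covDeriv (conn 𝔥 s) (fun y => horizontalFrame 𝔥 s y u) x v =
      -connCurvature (conn 𝔥 s) x u v (s x) :=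
  covDeriv_comm ((h.contDiffAt_conn hx).differentiableAt (by simp))
    ((h.contDiffAt hx).of_le (by norm_cast)) u v

omit hx in
theorem isMetricFrame (hJ : IsQuaternionic 𝔥 J) {g : 𝔼 n → Matrix (Fin n) (Fin n) ℝ}
    (hg : ∀ x ∈ U, ∀ i j, g x i j = inner ℝ
      (horizontalFrame 𝔥 s x (EuclideanSpace.single i 1))
      (horizontalFrame 𝔥 s x (EuclideanSpace.single j 1))) :
    IsMetricFrame g U (conn 𝔥 s) (horizontalFrame 𝔥 s) where
  isOpen := h.isOpen
  contDiffOn_conn x hx := (h.contDiffAt_conn hx).contDiffWithinAt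
  contDiffOn_frame x hx := (h.contDiffAt_horizontalFrame hx).contDiffWithinAt
  inner_conn_left x _ u := hJ.inner_apply_left _ (conn_mem s x u)
  injective x hx := h.injective_horizontalFrame hx
  metric_eq := hg
  torsion_free x hx u v w := by
    rw [← sub_eq_zero, ← inner_sub_left, h.covDeriv_horizontalFrame_sub hx, inner_neg_left,
      neg_eq_zero, real_inner_comm]
    exact h.inner_horizontalFrame_apply hx hJ w (h.connCurvature_mem hx hJ u v)

/-- Differentiate `⟪X(v), J T s⟫ = 0` and use that `∇` commutes with `J` and that
`∇_u (T s) = T X(u) + [T, A(u)] s`. -/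
theorem inner_covDeriv_horizontalFrame (hJ : IsQuaternionic 𝔥 J) (u v : 𝔼 n) (l : Fin 4)
    {T : V →L[ℝ] V} (hT : T ∈ 𝔥) :
    inner ℝ (covDeriv (conn 𝔥 s) (fun y => horizontalFrame 𝔥 s y v) x u) (J l (T (s x))) =
      -inner ℝ (horizontalFrame 𝔥 s x v) (J l (T (horizontalFrame 𝔥 s x u))) := by
  have hAu := conn_mem (𝔥 := 𝔥) s x u
  have hframe : DifferentiableAt ℝ (fun y => horizontalFrame 𝔥 s y v) x :=
    ((h.contDiffAt_horizontalFrame hx).differentiableAt (by simp)).clm_apply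
      (differentiableAt_const v)
  have hJT : HasFDerivAt (fun y => J l (T (s y))) ((J l ∘L T) ∘L fderiv ℝ s x) x :=
    (J l ∘L T).hasFDerivAt.comp x (h.differentiableAt hx).hasFDerivAt
  have hzero : (fun y => inner ℝ (horizontalFrame 𝔥 s y v) (J l (T (s y)))) =ᶠ[𝓝 x]
      fun _ => (0 : ℝ) := by
    filter_upwards [h.isOpen.mem_nhds hx] with y hy
      using h.inner_horizontalFrame_unit hy hJ v l hT
  have hderiv := fderiv_inner_eq_covDeriv (hJ.inner_apply_left _ hAu) hframe hJT.differentiableAt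
  rw [hzero.fderiv_eq, fderiv_const_apply, _root_.zero_apply] at hderiv
  have hcovJT : covDeriv (conn 𝔥 s) (fun y => J l (T (s y))) x u =
      J l (T (horizontalFrame 𝔥 s x u)) +
        J l ((T * conn 𝔥 s x u - conn 𝔥 s x u * T) (s x)) := by
    simp only [horizontalFrame_apply, covDeriv, hJT.fderiv, ContinuousLinearMap.comp_apply,
      ← hJ.unit_comm _ hAu, map_sub, _root_.sub_apply, mul_apply_eq_comp]
    abel
  rw [hcovJT, inner_add_right,
    h.inner_horizontalFrame_unit hx hJ v l (hJ.mul_sub_mul_mem T hT _ hAu), add_zero] at hderiv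
  linarith

end IsSlice

end Slice

/-! ## Curvature bounds for slices -/

section SliceCurvature

variable {V : Type*} [NormedAddCommGroup V] [InnerProductSpace ℝ V]
  {𝔥 : Submodule ℝ (V →L[ℝ] V)} {J : Fin 4 → V →L[ℝ] V}

section OrbitSum

variable {q : V}

/-- The map `(T₀, …, T₃) ↦ ∑ l, J l (T l q)`, whose range is the quaternionic span of the tangent
space `𝔥 q` of the orbit. -/
def orbitSum (𝔥 : Submodule ℝ (V →L[ℝ] V)) (J : Fin 4 → V →L[ℝ] V) (q : V) :
    (Fin 4 → 𝔥) →ₗ[ℝ] V where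
  toFun T := ∑ l, J l ((T l : V →L[ℝ] V) q)
  map_add' S T := by
    simp only [Pi.add_apply, Submodule.coe_add, _root_.add_apply, map_add, Finset.sum_add_distrib]
  map_smul' r T := by
    simp only [Pi.smul_apply, Submodule.coe_smul, _root_.smul_apply, map_smul, Finset.smul_sum,
      RingHom.id_apply]

theorem orbitSum_apply (T : Fin 4 → 𝔥) :
    orbitSum 𝔥 J q T = ∑ l, J l ((T l : V →L[ℝ] V) q) :=
  rfl

theorem unit_apply_mem_range_orbitSum (l : Fin 4) {T : V →L[ℝ] V} (hT : T ∈ 𝔥) :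
    J l (T q) ∈ LinearMap.range (orbitSum 𝔥 J q) := by
  refine ⟨Pi.single l ⟨T, hT⟩, ?_⟩
  rw [orbitSum_apply, Finset.sum_eq_single l (fun b _ hb => by simp [hb]) (by simp),
    Pi.single_eq_same]

variable (hJ : IsQuaternionic 𝔥 J) (hq : IsRegularPoint 𝔥 J q)

include hJ hq

theorem inner_unit_orbitSum (T : Fin 4 → 𝔥) (l : Fin 4) :
    inner ℝ (J l ((T l : V →L[ℝ] V) q)) (orbitSum 𝔥 J q T) = ‖(T l : V →L[ℝ] V) q‖ ^ 2 := by
  rw [orbitSum_apply, inner_sum, Finset.sum_eq_single l (fun b _ hb => ?_) (by simp),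
    real_inner_self_eq_norm_sq, hJ.norm_unit]
  exact hq.inner_unit_apply _ _ hb.symm _ (T _).2 _ (T _).2

theorem norm_orbitSum_sq (T : Fin 4 → 𝔥) :
    ‖orbitSum 𝔥 J q T‖ ^ 2 = ∑ l, ‖(T l : V →L[ℝ] V) q‖ ^ 2 := by
  rw [← real_inner_self_eq_norm_sq]
  nth_rw 1 [orbitSum_apply]
  rw [sum_inner]
  exact Finset.sum_congr rfl fun l _ => inner_unit_orbitSum hJ hq T l

theorem norm_apply_le_norm_orbitSum (T : Fin 4 → 𝔥) (l : Fin 4) :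
    ‖(T l : V →L[ℝ] V) q‖ ≤ ‖orbitSum 𝔥 J q T‖ := by
  refine (sq_le_sq₀ (norm_nonneg _) (norm_nonneg _)).1 ?_
  rw [norm_orbitSum_sq hJ hq]
  exact Finset.single_le_sum (f := fun l => ‖(T l : V →L[ℝ] V) q‖ ^ 2)
    (fun l _ => sq_nonneg _) (Finset.mem_univ l)

theorem orbitSum_injective : Function.Injective (orbitSum 𝔥 J q) :=
  (injective_iff_map_eq_zero _).2 fun T hT => funext fun l => Subtype.ext <|
    hq.eq_zero_of_apply_eq_zero _ (T l).2 <| norm_le_zero_iff.1 <| by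
      simpa only [hT, norm_zero] using norm_apply_le_norm_orbitSum hJ hq T l

theorem finrank_range_orbitSum [FiniteDimensional ℝ V] :
    Module.finrank ℝ (LinearMap.range (orbitSum 𝔥 J q)) = 4 * Module.finrank ℝ 𝔥 := by
  rw [LinearMap.finrank_range_of_inj (orbitSum_injective hJ hq), Module.finrank_pi_fintype]
  simp

theorem norm_orbitSum_le {δ C : ℝ} (hδ : 0 < δ) (hC : 0 ≤ C)
    (hb : ∀ T ∈ 𝔥, δ * ‖T‖ ≤ ‖T q‖) (T : Fin 4 → 𝔥)
    (hT : ∀ l, ∀ S ∈ 𝔥, |inner ℝ (orbitSum 𝔥 J q T) (J l (S q))| ≤ C * ‖S‖) :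
    ‖orbitSum 𝔥 J q T‖ ≤ 4 / δ * C := by
  set w := orbitSum 𝔥 J q T with hw
  have hnorm (l) : ‖(T l : V →L[ℝ] V)‖ ≤ ‖w‖ / δ := by
    rw [le_div_iff₀ hδ, mul_comm]
    exact (hb _ (T l).2).trans (norm_apply_le_norm_orbitSum hJ hq T l)
  have hsq : ‖w‖ * ‖w‖ ≤ (4 / δ * C) * ‖w‖ := calc
    ‖w‖ * ‖w‖ = ∑ l, inner ℝ w (J l ((T l : V →L[ℝ] V) q)) := by
      rw [← inner_sum, ← orbitSum_apply, ← hw, real_inner_self_eq_norm_mul_norm]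
    _ ≤ ∑ _l : Fin 4, C * (‖w‖ / δ) := Finset.sum_le_sum fun l _ =>
      (le_abs_self _).trans ((hT l _ (T l).2).trans (mul_le_mul_of_nonneg_left (hnorm l) hC))
    _ = (4 / δ * C) * ‖w‖ := by
      rw [Finset.sum_const, Finset.card_univ, Fintype.card_fin, nsmul_eq_mul]
      push_cast
      ring
  rcases (norm_nonneg w).eq_or_lt with hzero | hpos
  · rw [← hzero]
    positivity
  · exact le_of_mul_le_mul_right hsq hpos

end OrbitSum

namespace IsSlice

variable [FiniteDimensional ℝ V] {n : ℕ} {U : Set 𝔼 n} {s : 𝔼 n → V} (h : IsSlice 𝔥 J U s)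
  (hJ : IsQuaternionic 𝔥 J) {x : 𝔼 n} (hx : x ∈ U)

include h hJ hx

/-- The two subspaces are orthogonal, and their dimensions add up to `dim V`. -/
theorem range_orbitSum : LinearMap.range (orbitSum 𝔥 J (s x)) =
    (LinearMap.range (horizontalFrame 𝔥 s x : 𝔼 n →ₗ[ℝ] V))ᗮ := by
  have hle : LinearMap.range (orbitSum 𝔥 J (s x)) ≤
      (LinearMap.range (horizontalFrame 𝔥 s x : 𝔼 n →ₗ[ℝ] V))ᗮ := by
    rintro _ ⟨T, rfl⟩
    rw [Submodule.mem_orthogonal]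
    rintro _ ⟨u, rfl⟩
    rw [orbitSum_apply, inner_sum]
    exact Finset.sum_eq_zero fun l _ => h.inner_horizontalFrame_unit hx hJ u l (T l).2
  refine Submodule.eq_of_le_of_finrank_eq hle ?_
  have hadd :=
    (LinearMap.range (horizontalFrame 𝔥 s x : 𝔼 n →ₗ[ℝ] V)).finrank_add_finrank_orthogonal
  rw [LinearMap.finrank_range_of_inj (h.injective_horizontalFrame hx),
    finrank_euclideanSpace_fin, ← h.finrank_eq] at hadd
  rw [finrank_range_orbitSum hJ (h.isRegularPoint x hx)]
  exact (Nat.add_left_cancel hadd).symm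

variable {g : 𝔼 n → Matrix (Fin n) (Fin n) ℝ}
  (hg : ∀ x ∈ U, ∀ i j, g x i j = inner ℝ
    (horizontalFrame 𝔥 s x (EuclideanSpace.single i 1))
    (horizontalFrame 𝔥 s x (EuclideanSpace.single j 1)))

include hg

theorem inner_secondForm_unit (u v : 𝔼 n) (l : Fin 4) {T : V →L[ℝ] V} (hT : T ∈ 𝔥) :
    inner ℝ (secondForm g (conn 𝔥 s) (horizontalFrame 𝔥 s) x u v) (J l (T (s x))) =
      -inner ℝ (horizontalFrame 𝔥 s x v) (J l (T (horizontalFrame 𝔥 s x u))) := by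
  rw [(h.isMetricFrame hJ hg).secondForm_apply hx, inner_sub_left,
    h.inner_horizontalFrame_unit hx hJ _ l hT, sub_zero,
    h.inner_covDeriv_horizontalFrame hx hJ u v l hT]

theorem connCurvature_apply_slice (u v : 𝔼 n) :
    connCurvature (conn 𝔥 s) x u v (s x) =
      secondForm g (conn 𝔥 s) (horizontalFrame 𝔥 s) x v u -
        secondForm g (conn 𝔥 s) (horizontalFrame 𝔥 s) x u v := by
  have hm := h.isMetricFrame hJ hg
  rw [hm.secondForm_apply hx, hm.secondForm_apply hx, hm.christoffelMap_comm hx v u,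
    sub_sub_sub_cancel_right, ← neg_inj, ← h.covDeriv_horizontalFrame_sub hx u v, neg_sub]

variable {δ : ℝ} (hδ : 0 < δ) (hb : ∀ T ∈ 𝔥, δ * ‖T‖ ≤ ‖T (s x)‖)

include hδ hb

theorem norm_secondForm_le (u v : 𝔼 n) :
    ‖secondForm g (conn 𝔥 s) (horizontalFrame 𝔥 s) x u v‖ ≤
      4 / δ * (‖horizontalFrame 𝔥 s x u‖ * ‖horizontalFrame 𝔥 s x v‖) := by
  have hm := h.isMetricFrame hJ hg
  have hmem : secondForm g (conn 𝔥 s) (horizontalFrame 𝔥 s) x u v ∈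
      LinearMap.range (orbitSum 𝔥 J (s x)) := by
    rw [h.range_orbitSum hJ hx, Submodule.mem_orthogonal']
    rintro _ ⟨w, rfl⟩
    exact hm.inner_secondForm hx u v w
  obtain ⟨T, hT⟩ := hmem
  rw [← hT]
  refine norm_orbitSum_le hJ (h.isRegularPoint x hx) hδ (by positivity) hb T fun l S hS => ?_
  rw [hT, h.inner_secondForm_unit hJ hx hg u v l hS, abs_neg]
  calc |inner ℝ (horizontalFrame 𝔥 s x v) (J l (S (horizontalFrame 𝔥 s x u)))|
      ≤ ‖horizontalFrame 𝔥 s x v‖ * ‖J l (S (horizontalFrame 𝔥 s x u))‖ :=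
        abs_real_inner_le_norm _ _
    _ ≤ ‖horizontalFrame 𝔥 s x v‖ * (‖S‖ * ‖horizontalFrame 𝔥 s x u‖) := by
      rw [hJ.norm_unit]
      gcongr
      exact S.le_opNorm _
    _ = ‖horizontalFrame 𝔥 s x u‖ * ‖horizontalFrame 𝔥 s x v‖ * ‖S‖ := by ring

theorem norm_connCurvature_le (u v : 𝔼 n) :
    ‖connCurvature (conn 𝔥 s) x u v‖ ≤
      8 / δ ^ 2 * (‖horizontalFrame 𝔥 s x u‖ * ‖horizontalFrame 𝔥 s x v‖) := by
  have hvalue : δ * ‖connCurvature (conn 𝔥 s) x u v‖ ≤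
      8 / δ * (‖horizontalFrame 𝔥 s x u‖ * ‖horizontalFrame 𝔥 s x v‖) := by
    refine (hb _ (h.connCurvature_mem hx hJ u v)).trans ?_
    rw [h.connCurvature_apply_slice hJ hx hg]
    refine (norm_sub_le_of_le (h.norm_secondForm_le hJ hx hg hδ hb v u)
      (h.norm_secondForm_le hJ hx hg hδ hb u v)).trans_eq ?_
    ring
  rw [← mul_le_mul_iff_right₀ hδ]
  refine hvalue.trans_eq ?_
  field_simp

theorem abs_sectionalCurvature_le {u v : 𝔼 n} (huv : LinearIndependent ℝ ![u, v]) :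
    |sectionalCurvature g x u v| ≤ 40 / δ ^ 2 := by
  refine ((h.isMetricFrame hJ hg).abs_sectionalCurvature_le hx
    (h.norm_connCurvature_le hJ hx hg hδ hb) (h.norm_secondForm_le hJ hx hg hδ hb) huv).trans_eq ?_
  field_simp
  norm_num

end IsSlice

end SliceCurvature

/-! ## Existence of slices -/

section SliceExistence

variable {V : Type*} [NormedAddCommGroup V] [NormedSpace ℝ V] [FiniteDimensional ℝ V]
  {W : Type*} [NormedAddCommGroup W] [NormedSpace ℝ W]

theorem exists_chart_of_surjective_fderiv [FiniteDimensional ℝ W] {m : V → W}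
    (hm : ContDiff ℝ ω m) {q₀ : V} {D : V →L[ℝ] W} (hD : HasFDerivAt m D q₀)
    (hsurj : Function.Surjective D) :
    ∃ χ : V → V, χ 0 = q₀ ∧ ContDiffAt ℝ ω χ 0 ∧
      HasStrictFDerivAt χ (ContinuousLinearMap.id ℝ V) 0 ∧
      ∀ᶠ v in 𝓝 0, m (χ v) = m q₀ + D v := by
  have : CompleteSpace V := FiniteDimensional.complete ℝ V
  obtain ⟨R₀, hR₀⟩ := LinearMap.exists_rightInverse_of_surjective (D : V →ₗ[ℝ] W)
    (LinearMap.range_eq_top.2 hsurj)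
  let R : W →L[ℝ] V := LinearMap.toContinuousLinearMap R₀
  have hDR (w : W) : D (R w) = w := LinearMap.congr_fun hR₀ w
  let Ψ : V → V := fun q => q - q₀ - R (D (q - q₀)) + R (m q - m q₀)
  have hDΨ (q : V) : D (Ψ q) = m q - m q₀ := by simp [Ψ, hDR]
  have hΨ₀ : Ψ q₀ = 0 := by simp [Ψ]
  have hΨω : ContDiffAt ℝ ω Ψ q₀ := ContDiff.contDiffAt (by fun_prop)
  have hΨ' : HasFDerivAt Ψ ((ContinuousLinearEquiv.refl ℝ V : V ≃L[ℝ] V) : V →L[ℝ] V) q₀ := by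
    have hid : HasFDerivAt (fun q : V => q - q₀) (ContinuousLinearMap.id ℝ V) q₀ :=
      (hasFDerivAt_id q₀).sub_const q₀
    refine ((hid.sub (R.hasFDerivAt.comp q₀ (D.hasFDerivAt.comp q₀ hid))).add
      (R.hasFDerivAt.comp q₀ (hD.sub_const (m q₀)))).congr_fderiv ?_
    ext v
    simp
  have hstrict := hΨω.hasStrictFDerivAt' hΨ' (by simp)
  have hχω := hΨω.to_localInverse hΨ' (n := ω) (by simp)
  have hχ₀ := hstrict.localInverse_apply_image
  have hχ' := hstrict.to_localInverse
  have hχ := hstrict.eventually_right_inverse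
  rw [hΨ₀] at hχω hχ₀ hχ' hχ
  refine ⟨hstrict.localInverse Ψ _ q₀, hχ₀, hχω, hχ', ?_⟩
  filter_upwards [hχ] with v hv
  rw [← sub_eq_iff_eq_add', ← hDΨ]
  exact congrArg D hv

/-- `H` parametrizes a complement of the tangent space `𝔥 q₀` of the orbit in the kernel of `D`, the
infinitesimal action being free at `q₀`. -/
structure IsTangentSlice {n : ℕ} (𝔥 : Submodule ℝ (V →L[ℝ] V)) (D : V →L[ℝ] W) (q₀ : V)
    (H : 𝔼 n →L[ℝ] V) : Prop where
  map_orbit : ∀ T ∈ 𝔥, D (T q₀) = 0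
  map_param : ∀ x, D (H x) = 0
  exists_eq_add : ∀ v, D v = 0 → ∃ T ∈ 𝔥, ∃ x, v = T q₀ + H x
  eq_zero : ∀ T ∈ 𝔥, ∀ x, T q₀ + H x = 0 → T = 0 ∧ x = 0

/-- The orbit coordinate `α` and the slice coordinate `η` on `𝔥 q₀ ⊕ range H`, both extended to the
whole space. -/
structure IsOrbitSplitting {n : ℕ} (𝔥 : Submodule ℝ (V →L[ℝ] V)) (q₀ : V) (H : 𝔼 n →L[ℝ] V)
    (α : V →L[ℝ] V →L[ℝ] V) (η : V →L[ℝ] 𝔼 n) : Prop where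
  mem : ∀ v, α v ∈ 𝔥
  orbit_add : ∀ T ∈ 𝔥, ∀ x, α (T q₀ + H x) = T
  slice_add : ∀ T ∈ 𝔥, ∀ x, η (T q₀ + H x) = x

/-- A local slice for the action of `S` on a level set of `m`. -/
structure IsLevelSlice {n : ℕ} (S : Submonoid (V →L[ℝ] V)) (𝔥 : Submodule ℝ (V →L[ℝ] V))
    (m : V → W) (κ : W) (U : Set 𝔼 n) (s : 𝔼 n → V) : Prop where
  isOpen : IsOpen U
  contDiffOn : ContDiffOn ℝ ∞ s U
  map_eq : ∀ x ∈ U, m (s x) = κ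
  transverse : ∀ x ∈ U, ∀ u, ∀ T ∈ 𝔥, fderiv ℝ s x u = T (s x) → u = 0
  eq_of_mem_orbit : ∀ x ∈ U, ∀ y ∈ U, ∀ T ∈ S, T (s x) = s y → x = y
  eventually_mem_orbit : ∀ x ∈ U, ∀ N ∈ 𝓝 x, ∀ᶠ q in 𝓝 (s x), m q = κ →
    ∃ T ∈ S, ∃ y ∈ N, q = T (s y)

/-- The map `v ↦ exp (α v) (χ (v - α v q₀))`, which turns a chart `χ` at `q₀` into one that also
straightens the orbits. -/
def orbitChart (α : V →L[ℝ] V →L[ℝ] V) (χ : V → V) (q₀ v : V) : V :=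
  NormedSpace.exp (α v) (χ (v - α v q₀))

theorem hasStrictFDerivAt_orbitChart (α : V →L[ℝ] V →L[ℝ] V) {χ : V → V}
    (hχ : HasStrictFDerivAt χ (ContinuousLinearMap.id ℝ V) 0) :
    HasStrictFDerivAt (orbitChart α χ (χ 0)) (ContinuousLinearMap.id ℝ V) 0 := by
  have : CompleteSpace V := FiniteDimensional.complete ℝ V
  let κ : V →L[ℝ] V := α.flip (χ 0)
  have hexp : HasStrictFDerivAt (fun v => NormedSpace.exp (α v)) α 0 :=
    HasStrictFDerivAt.comp (g := NormedSpace.exp) (f := α) (x := (0 : V)) (g' := 1)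
      (by rw [map_zero]; exact hasStrictFDerivAt_exp_zero) α.hasStrictFDerivAt
  have hshift : HasStrictFDerivAt (fun v => χ (v - κ v)) (ContinuousLinearMap.id ℝ V - κ) 0 :=
    HasStrictFDerivAt.comp (g := χ) (f := (ContinuousLinearMap.id ℝ V - κ : V →L[ℝ] V))
      (x := (0 : V)) (g' := ContinuousLinearMap.id ℝ V) (by rw [map_zero]; exact hχ)
      (ContinuousLinearMap.id ℝ V - κ).hasStrictFDerivAt
  refine (hexp.clm_apply hshift).congr_fderiv ?_
  ext v
  simp [κ]

variable {n : ℕ} {𝔥 : Submodule ℝ (V →L[ℝ] V)} {q₀ : V} {H : 𝔼 n →L[ℝ] V}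



theorem IsTangentSlice.injective_coprod {D : V →L[ℝ] W} (h : IsTangentSlice 𝔥 D q₀ H) :
    Function.Injective (((coordMap 𝔥).flip q₀).coprod H) := by
  refine (injective_iff_map_eq_zero _).2 fun p hp => ?_
  obtain ⟨hp₁, hp₂⟩ := h.eq_zero _ (coordMap_mem 𝔥 p.1) p.2 hp
  exact Prod.ext ((map_eq_zero_iff _ (coordMap_injective 𝔥)).1 hp₁) hp₂

theorem IsTangentSlice.exists_isOrbitSplitting {D : V →L[ℝ] W} (h : IsTangentSlice 𝔥 D q₀ H) :
    ∃ α η, IsOrbitSplitting 𝔥 q₀ H α η := by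
  obtain ⟨l, hl⟩ := LinearMap.exists_leftInverse_of_injective
    (((coordMap 𝔥).flip q₀).coprod H).toLinearMap (LinearMap.ker_eq_bot.2 h.injective_coprod)
  have hl_apply (a x) : l (coordMap 𝔥 a q₀ + H x) = (a, x) := LinearMap.congr_fun hl (a, x)
  let lc := LinearMap.toContinuousLinearMap l
  refine ⟨(coordMap 𝔥).comp ((ContinuousLinearMap.fst ℝ _ _).comp lc),
    (ContinuousLinearMap.snd ℝ _ _).comp lc, fun v => coordMap_mem 𝔥 _, fun T hT x => ?_,
    fun T hT x => ?_⟩ <;> obtain ⟨a, rfl⟩ := exists_coordMap_eq 𝔥 hT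
  · exact congrArg (coordMap 𝔥) (congrArg Prod.fst (hl_apply a x))
  · exact congrArg Prod.snd (hl_apply a x)

theorem eventually_transverse {s : 𝔼 n → V} {x₀ : 𝔼 n} (hs : ContDiffAt ℝ ω s x₀)
    (hinj : Function.Injective (((coordMap 𝔥).flip (s x₀)).coprod (fderiv ℝ s x₀))) :
    ∀ᶠ x in 𝓝 x₀, ∀ u, ∀ T ∈ 𝔥, fderiv ℝ s x u = T (s x) → u = 0 := by
  have hcont : ContinuousAt (fun x => ((coordMap 𝔥).flip (s x)).coprod (fderiv ℝ s x)) x₀ :=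
    ((coordMap 𝔥).flip.continuous.continuousAt.comp hs.continuousAt).continuousLinearMapCoprod
      (hs.fderiv_right (m := ω) (by simp)).continuousAt
  filter_upwards [hcont.eventually (ContinuousLinearMap.isOpen_injective.mem_nhds hinj)]
    with x hx u T hT hu
  obtain ⟨a, rfl⟩ := exists_coordMap_eq 𝔥 hT
  have hzero : (((coordMap 𝔥).flip (s x)).coprod (fderiv ℝ s x)) (-a, u) = 0 := by
    simp [hu]
  exact congrArg Prod.snd ((map_eq_zero_iff _ hx).1 hzero)

namespace IsOrbitSplitting

variable {α : V →L[ℝ] V →L[ℝ] V} {η : V →L[ℝ] 𝔼 n} (h : IsOrbitSplitting 𝔥 q₀ H α η)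

include h

omit [FiniteDimensional ℝ V] in
theorem orbit_param (x : 𝔼 n) : α (H x) = 0 := by
  simpa using h.orbit_add 0 (zero_mem _) x

omit [FiniteDimensional ℝ V] in
theorem slice_param (x : 𝔼 n) : η (H x) = x := by
  simpa using h.slice_add 0 (zero_mem _) x

omit [FiniteDimensional ℝ V] in
theorem orbitChart_add (χ : V → V) {T : V →L[ℝ] V} (hT : T ∈ 𝔥) (x : 𝔼 n) :
    orbitChart α χ q₀ (T q₀ + H x) = NormedSpace.exp T (χ (H x)) := by
  rw [orbitChart, h.orbit_add T hT, add_sub_cancel_left]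

omit [FiniteDimensional ℝ V] in
theorem orbitChart_param (χ : V → V) (x : 𝔼 n) : orbitChart α χ q₀ (H x) = χ (H x) := by
  simpa using h.orbitChart_add χ (zero_mem 𝔥) x

theorem eventually_mem_orbit {S : Submonoid (V →L[ℝ] V)} (hS : IsClosedGroup S 𝔥)
    {m : V → W} {D : V →L[ℝ] W} (hD : IsTangentSlice 𝔥 D q₀ H)
    (hmS : ∀ T ∈ S, ∀ q, m q = m q₀ → m (T q) = m q₀) {χ : V → V} {x : 𝔼 n}
    (hχ : ∀ᶠ v in 𝓝 (H x), m (χ v) = m q₀ + D v)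
    (hmap : map (orbitChart α χ q₀) (𝓝 (H x)) = 𝓝 (χ (H x))) {N : Set 𝔼 n} (hN : N ∈ 𝓝 x) :
    ∀ᶠ q in 𝓝 (χ (H x)), m q = m q₀ → ∃ T ∈ S, ∃ y ∈ N, q = T (χ (H y)) := by
  have : CompleteSpace V := FiniteDimensional.complete ℝ V
  have hη : Tendsto η (𝓝 (H x)) (𝓝 x) := η.continuous.tendsto' _ _ (h.slice_param x)
  have hshift : Tendsto (fun v => v - α v q₀) (𝓝 (H x)) (𝓝 (H x)) :=
    Continuous.tendsto' (by fun_prop) _ _ (by simp [h.orbit_param])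
  rw [← hmap, eventually_map]
  filter_upwards [hη.eventually hN, hshift.eventually hχ] with v hvN hv hlevel
  have hDv : D v = 0 := by
    have hback : m (χ (v - α v q₀)) = m q₀ := by
      have := hmS _ (hS.exp_mem (𝔥.neg_mem (h.mem v))) _ hlevel
      rwa [orbitChart, ← mul_apply_eq_comp, exp_neg_mul_exp, one_apply_eq_self] at this
    simpa [hback, hD.map_orbit _ (h.mem v)] using hv
  obtain ⟨T, hT, y, rfl⟩ := hD.exists_eq_add v hDv
  exact ⟨_, hS.exp_mem hT, y, h.slice_add T hT y ▸ hvN, h.orbitChart_add χ hT y⟩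

/-- A group element carrying one point of the slice to another moves `q₀` only a little, hence is
the exponential of a small `X ∈ 𝔥`, and the orbit chart takes the same value at `X q₀ + H x` and
`H y`. -/
theorem eventually_eq_of_mem_orbit {S : Submonoid (V →L[ℝ] V)} (hS : IsIsometryGroup S 𝔥)
    (hfree : ∀ T ∈ S, T q₀ = q₀ → T = 1) {χ : V → V} (hχ₀ : χ 0 = q₀) (hχ : ContinuousAt χ 0)
    {N : Set V} (hN : N ∈ 𝓝 0) (hinj : Set.InjOn (orbitChart α χ q₀) N) :
    ∃ M ∈ 𝓝 (0 : 𝔼 n), ∀ x ∈ M, ∀ y ∈ M, ∀ T ∈ S, T (χ (H x)) = χ (H y) → x = y := by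
  obtain ⟨ρ, hρ, hball⟩ := Metric.mem_nhds_iff.1 hN
  obtain ⟨δ, hδ, hexp⟩ := hS.exists_exp_of_norm_sub_lt hfree
    (ε := ρ / 2 / (‖q₀‖ + 1)) (by positivity)
  have hH : Tendsto H (𝓝 0) (𝓝 0) := H.continuous.tendsto' _ _ (map_zero H)
  have hs : Tendsto (fun x => χ (H x)) (𝓝 0) (𝓝 q₀) := hχ₀ ▸ hχ.tendsto.comp hH
  refine ⟨_, (hs.eventually (Metric.ball_mem_nhds q₀ (half_pos hδ))).and
    (hH.eventually (Metric.ball_mem_nhds 0 (half_pos hρ))), ?_⟩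
  rintro x ⟨hxq, hxρ⟩ y ⟨hyq, hyρ⟩ T hT hTxy
  rw [dist_eq_norm] at hxq hyq
  rw [dist_zero_right] at hxρ hyρ
  have hmove : ‖T q₀ - q₀‖ < δ := by
    calc ‖T q₀ - q₀‖ = ‖(χ (H y) - q₀) - T (χ (H x) - q₀)‖ := by
          rw [map_sub, hTxy, sub_sub_sub_cancel_left, norm_sub_rev]
      _ ≤ ‖χ (H y) - q₀‖ + ‖T (χ (H x) - q₀)‖ := norm_sub_le _ _
      _ = ‖χ (H y) - q₀‖ + ‖χ (H x) - q₀‖ := by rw [hS.norm_apply T hT]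
      _ < δ := by linarith
  obtain ⟨X, hX, hXε, rfl⟩ := hexp T hT hmove
  have hXq : ‖X q₀‖ < ρ / 2 := by
    calc ‖X q₀‖ ≤ ‖X‖ * ‖q₀‖ := X.le_opNorm _
      _ ≤ ‖X‖ * (‖q₀‖ + 1) := by gcongr; linarith
      _ < ρ / 2 / (‖q₀‖ + 1) * (‖q₀‖ + 1) := by gcongr
      _ = ρ / 2 := by field_simp
  have heq : X q₀ + H x = H y := by
    refine hinj (hball ?_) (hball ?_) ?_
    · rw [mem_ball_zero_iff]
      linarith [norm_add_le (X q₀) (H x)]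
    · rw [mem_ball_zero_iff]
      linarith
    · rw [h.orbitChart_add χ hX, h.orbitChart_param, hTxy]
  rw [← h.slice_add X hX x, heq, h.slice_param]

end IsOrbitSplitting

theorem exists_isLevelSlice [FiniteDimensional ℝ W] {S : Submonoid (V →L[ℝ] V)}
    (hS : IsIsometryGroup S 𝔥) {m : V → W} (hm : ContDiff ℝ ω m)
    (hmS : ∀ T ∈ S, ∀ q, m q = m q₀ → m (T q) = m q₀)
    (hfree : ∀ T ∈ S, T q₀ = q₀ → T = 1) {D : V →L[ℝ] W} (hD : HasFDerivAt m D q₀)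
    (hsurj : Function.Surjective D) (hH : IsTangentSlice 𝔥 D q₀ H) :
    ∃ (U : Set 𝔼 n) (s : 𝔼 n → V), 0 ∈ U ∧ s 0 = q₀ ∧ IsLevelSlice S 𝔥 m (m q₀) U s := by
  have : CompleteSpace V := FiniteDimensional.complete ℝ V
  obtain ⟨χ, hχ₀, hχω, hχ', hmχ⟩ := exists_chart_of_surjective_fderiv hm hD hsurj
  obtain ⟨α, η, hαη⟩ := hH.exists_isOrbitSplitting
  have hΞ : HasStrictFDerivAt (orbitChart α χ q₀)
      ((ContinuousLinearEquiv.refl ℝ V : V ≃L[ℝ] V) : V →L[ℝ] V) 0 :=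
    hχ₀ ▸ hasStrictFDerivAt_orbitChart α hχ'
  let e := hΞ.toOpenPartialHomeomorph
  have hsource : e.source ∈ 𝓝 0 := e.open_source.mem_nhds hΞ.mem_toOpenPartialHomeomorph_source
  obtain ⟨M, hM, hinj⟩ :=
    hαη.eventually_eq_of_mem_orbit hS hfree hχ₀ hχω.continuousAt hsource e.injOn
  have hH₀ : Tendsto H (𝓝 0) (𝓝 0) := H.continuous.tendsto' _ _ (map_zero H)
  let s : 𝔼 n → V := fun x => χ (H x)
  have hs₀ : s 0 = q₀ := by simp [s, hχ₀]
  have hsω : ContDiffAt ℝ ω s 0 :=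
    ContDiffAt.comp 0 (by rwa [map_zero]) H.contDiff.contDiffAt
  have hs' : fderiv ℝ s 0 = H :=
    (HasFDerivAt.comp (g := χ) (g' := ContinuousLinearMap.id ℝ V) (0 : 𝔼 n)
      (by rw [map_zero]; exact hχ'.hasFDerivAt) H.hasFDerivAt).fderiv
  have htransverse := eventually_transverse (𝔥 := 𝔥) hsω
    (by rw [hs₀, hs']; exact hH.injective_coprod)
  obtain ⟨U, hU, hUopen, h0U⟩ := eventually_nhds_iff.1 <| (hsω.eventually (by simp)).and <|
    htransverse.and <| (hH₀.eventually hmχ.eventually_nhds).and <|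
    (hH₀.eventually hsource).and hM
  refine ⟨U, s, h0U, hs₀, hUopen, fun x hx => ((hU x hx).1.of_le le_top).contDiffWithinAt,
    fun x hx => ?_, fun x hx => (hU x hx).2.1, fun x hx y hy => hinj x (hU x hx).2.2.2.2 y
    (hU y hy).2.2.2.2, fun x hx N hN => ?_⟩
  · simpa [hH.map_param] using (hU x hx).2.2.1.self_of_nhds
  · have hmap := e.map_nhds_eq (hU x hx).2.2.2.1
    exact hαη.eventually_mem_orbit hS.toIsClosedGroup hH hmS (hU x hx).2.2.1
      (hmap.trans (congrArg 𝓝 (hαη.orbitChart_param χ x))) hN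

end SliceExistence

/-! ## The moment map -/

section MomentMap

variable {V : Type*} [NormedAddCommGroup V] [InnerProductSpace ℝ V] [FiniteDimensional ℝ V]

section MomentCoordinates

variable (𝔥 : Submodule ℝ (V →L[ℝ] V)) (J : Fin 4 → V →L[ℝ] V)

theorem coordMap_eq_sum (a : Fin (Module.finrank ℝ 𝔥) → ℝ) :
    coordMap 𝔥 a = ∑ i, a i • coordMap 𝔥 (Pi.single i 1) := by
  conv_lhs => rw [pi_eq_sum_univ' a]
  simp only [map_sum, map_smul]

/-- The coordinates `⟪T q, J l q⟫`, `l = 1, 2, 3`, of the moment map, with `T` in a basis of `𝔥`. -/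
def momentCoord (q : V) : Fin 3 → Fin (Module.finrank ℝ 𝔥) → ℝ :=
  fun l i => inner ℝ (coordMap 𝔥 (Pi.single i 1) q) (J l.succ q)

/-- The derivative of `momentCoord` at `q`. -/
def momentDeriv (q : V) : V →L[ℝ] Fin 3 → Fin (Module.finrank ℝ 𝔥) → ℝ :=
  ContinuousLinearMap.pi fun l => ContinuousLinearMap.pi fun i =>
    (-2 : ℝ) • innerSL ℝ (J l.succ (coordMap 𝔥 (Pi.single i 1) q))

theorem contDiff_momentCoord : ContDiff ℝ ω (momentCoord 𝔥 J) :=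
  contDiff_pi.2 fun _ => contDiff_pi.2 fun _ =>
    (ContinuousLinearMap.contDiff _).inner ℝ (ContinuousLinearMap.contDiff _)

theorem momentCoord_smul (r : ℝ) (q : V) :
    momentCoord 𝔥 J (r • q) = r ^ 2 • momentCoord 𝔥 J q := by
  funext l i
  simp only [momentCoord, map_smul, real_inner_smul_left, real_inner_smul_right, Pi.smul_apply,
    smul_eq_mul]
  ring

variable {𝔥 J}

theorem momentCoord_zero : momentCoord 𝔥 J 0 = 0 := by
  simpa using momentCoord_smul 𝔥 J 0 0

theorem momentCoord_eq_iff {q q' : V} :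
    momentCoord 𝔥 J q = momentCoord 𝔥 J q' ↔
      ∀ l, l ≠ 0 → ∀ T ∈ 𝔥, (inner ℝ (T q) (J l q) : ℝ) = inner ℝ (T q') (J l q') := by
  refine ⟨fun h l hl T hT => ?_,
    fun h => funext fun l => funext fun i => h _ l.succ_ne_zero _ (coordMap_mem 𝔥 _)⟩
  obtain ⟨a, rfl⟩ := exists_coordMap_eq 𝔥 hT
  obtain ⟨l, rfl⟩ := Fin.exists_succ_eq.2 hl
  simp only [coordMap_eq_sum 𝔥 a, _root_.sum_apply, _root_.smul_apply, sum_inner,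
    real_inner_smul_left]
  exact Finset.sum_congr rfl fun i _ => congrArg (a i * ·) (congrFun (congrFun h l) i)

theorem momentDeriv_eq_zero_iff {q v : V} :
    momentDeriv 𝔥 J q v = 0 ↔ ∀ l, l ≠ 0 → ∀ T ∈ 𝔥, (inner ℝ (J l (T q)) v : ℝ) = 0 := by
  have happly (l i) : momentDeriv 𝔥 J q v l i =
    -2 * inner ℝ (J l.succ (coordMap 𝔥 (Pi.single i 1) q)) v := rfl
  refine ⟨fun h l hl T hT => ?_, fun h => funext fun l => funext fun i => ?_⟩
  · obtain ⟨a, rfl⟩ := exists_coordMap_eq 𝔥 hT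
    obtain ⟨l, rfl⟩ := Fin.exists_succ_eq.2 hl
    have hbasis (i) : inner ℝ (J l.succ (coordMap 𝔥 (Pi.single i 1) q)) v = (0 : ℝ) := by
      simpa [happly] using congrFun (congrFun h l) i
    simp only [coordMap_eq_sum 𝔥 a, _root_.sum_apply, _root_.smul_apply, map_sum, map_smul,
      sum_inner, real_inner_smul_left, hbasis, mul_zero, Finset.sum_const_zero]
  · rw [happly, h _ l.succ_ne_zero _ (coordMap_mem 𝔥 _), mul_zero]
    rfl

theorem exists_le_norm_apply_add_norm_momentCoord
    (hfree : ∀ q, q ≠ 0 → momentCoord 𝔥 J q = 0 → ∀ T ∈ 𝔥, T q = 0 → T = 0) :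
    ∃ δ > 0, ∀ T ∈ 𝔥, ‖T‖ = 1 → ∀ q, ‖q‖ = 1 → δ ≤ ‖T q‖ + ‖momentCoord 𝔥 J q‖ := by
  have : ProperSpace V := FiniteDimensional.proper ℝ V
  have : ProperSpace (V →L[ℝ] V) := FiniteDimensional.proper ℝ _
  have hcompact : IsCompact
      (((𝔥 : Set (V →L[ℝ] V)) ∩ Metric.sphere 0 1) ×ˢ Metric.sphere (0 : V) 1) :=
    ((isCompact_sphere _ _).inter_left (Submodule.closed_of_finiteDimensional 𝔥)).prod
      (isCompact_sphere _ _)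
  have hcont : Continuous fun p : (V →L[ℝ] V) × V => ‖p.1 p.2‖ + ‖momentCoord 𝔥 J p.2‖ :=
    (continuous_fst.clm_apply continuous_snd).norm.add
      ((contDiff_momentCoord 𝔥 J).continuous.comp continuous_snd).norm
  obtain ⟨δ, hδ, hle⟩ := hcompact.exists_forall_le' hcont.continuousOn (a := 0) <| by
    rintro ⟨T, q⟩ ⟨⟨hT, hT₁⟩, hq₁⟩
    refine (add_nonneg (norm_nonneg _) (norm_nonneg _)).lt_of_ne' fun hzero => ?_
    rw [add_eq_zero_iff_of_nonneg (norm_nonneg _) (norm_nonneg _), norm_eq_zero,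
      norm_eq_zero] at hzero
    exact ne_zero_of_mem_unit_sphere ⟨T, hT₁⟩ <|
      hfree q (ne_zero_of_mem_unit_sphere ⟨q, hq₁⟩) hzero.2 T hT hzero.1
  exact ⟨δ, hδ, fun T hT hT₁ q hq₁ => hle (T, q)
    ⟨⟨hT, mem_sphere_zero_iff_norm.2 hT₁⟩, mem_sphere_zero_iff_norm.2 hq₁⟩⟩

/-- By compactness, `δ ≤ ‖T q‖ + ‖μ q‖` for unit `T` and `q`; as `μ` is homogeneous of degree two,
on a fixed level the second summand is negligible after rescaling a long vector `q` to length
one. -/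
theorem exists_mul_norm_le_norm_apply
    (hfree : ∀ q, q ≠ 0 → momentCoord 𝔥 J q = 0 → ∀ T ∈ 𝔥, T q = 0 → T = 0)
    (κ : Fin 3 → Fin (Module.finrank ℝ 𝔥) → ℝ) :
    ∃ δ > 0, ∃ R > 0, ∀ q, momentCoord 𝔥 J q = κ → R ≤ ‖q‖ →
      ∀ T ∈ 𝔥, δ * ‖q‖ * ‖T‖ ≤ ‖T q‖ := by
  obtain ⟨δ, hδ, hle⟩ := exists_le_norm_apply_add_norm_momentCoord hfree
  refine ⟨δ / 2, half_pos hδ, 1 + 2 * ‖κ‖ / δ, by positivity, fun q hq hR T hT => ?_⟩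
  have hRle : 2 * ‖κ‖ / δ ≤ ‖q‖ := by linarith
  have hq₁ : 1 ≤ ‖q‖ := (le_add_of_nonneg_right (by positivity)).trans hR
  have hqpos : 0 < ‖q‖ := one_pos.trans_le hq₁
  rcases eq_or_ne T 0 with rfl | hT₀
  · simp
  have hTpos : 0 < ‖T‖ := norm_pos_iff.2 hT₀
  have hunit := hle (‖T‖⁻¹ • T) (𝔥.smul_mem _ hT) (norm_smul_inv_norm hT₀) (‖q‖⁻¹ • q)
    (norm_smul_inv_norm (norm_pos_iff.1 hqpos))
  have happly : ‖(‖T‖⁻¹ • T) (‖q‖⁻¹ • q)‖ = ‖T q‖ / (‖q‖ * ‖T‖) := by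
    rw [_root_.smul_apply, map_smul, norm_smul, norm_smul, norm_inv, norm_inv, norm_norm, norm_norm]
    field_simp
  have hmoment : ‖momentCoord 𝔥 J (‖q‖⁻¹ • q)‖ ≤ δ / 2 := by
    rw [momentCoord_smul, hq, norm_smul, norm_pow, norm_inv, norm_norm, inv_pow,
      inv_mul_le_iff₀ (by positivity)]
    rw [div_le_iff₀ hδ] at hRle
    linarith [mul_le_mul_of_nonneg_right (le_self_pow₀ hq₁ two_ne_zero) hδ.le]
  have hquot : δ / 2 ≤ ‖T q‖ / (‖q‖ * ‖T‖) := by linarith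
  rwa [le_div_iff₀ (by positivity), ← mul_assoc] at hquot

end MomentCoordinates

namespace IsQuaternionic

variable {𝔥 : Submodule ℝ (V →L[ℝ] V)} {J : Fin 4 → V →L[ℝ] V} (hJ : IsQuaternionic 𝔥 J)

include hJ

omit [FiniteDimensional ℝ V] in
theorem inner_add_inner_swap {T : V →L[ℝ] V} (hT : T ∈ 𝔥) {l : Fin 4} (hl : l ≠ 0) (q v : V) :
    inner ℝ (T q) (J l v) + inner ℝ (T v) (J l q) = -2 * inner ℝ (J l (T q)) v := by
  rw [hJ.inner_apply_left T hT v, ← hJ.unit_comm T hT]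
  linarith [hJ.inner_unit_left l hl (T q) v, real_inner_comm v (J l (T q))]

omit [FiniteDimensional ℝ V] in
theorem hasFDerivAt_inner {T : V →L[ℝ] V} (hT : T ∈ 𝔥) {l : Fin 4} (hl : l ≠ 0) {E : Type*}
    [NormedAddCommGroup E] [NormedSpace ℝ E] {s : E → V} {s' : E →L[ℝ] V} {x : E}
    (hs : HasFDerivAt s s' x) :
    HasFDerivAt (fun y => inner ℝ (T (s y)) (J l (s y)))
      ((-2 : ℝ) • (innerSL ℝ (J l (T (s x)))).comp s') x := by
  refine ((T.hasFDerivAt.comp x hs).inner ℝ ((J l).hasFDerivAt.comp x hs)).congr_fderiv ?_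
  ext v
  exact hJ.inner_add_inner_swap hT hl (s x) (s' v)

theorem hasFDerivAt_momentCoord (q : V) :
    HasFDerivAt (momentCoord 𝔥 J) (momentDeriv 𝔥 J q) q :=
  hasFDerivAt_pi'.2 fun l => hasFDerivAt_pi'.2 fun _ =>
    hJ.hasFDerivAt_inner (coordMap_mem 𝔥 _) l.succ_ne_zero (hasFDerivAt_id q)

theorem isRegularPoint {S : Submonoid (V →L[ℝ] V)} (hS : IsClosedGroup S 𝔥) {q : V}
    (hinv : ∀ T ∈ S, momentCoord 𝔥 J (T q) = momentCoord 𝔥 J q)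
    (hinj : ∀ T ∈ 𝔥, T q = 0 → T = 0) : IsRegularPoint 𝔥 J q := by
  have : CompleteSpace V := FiniteDimensional.complete ℝ V
  refine ⟨hinj, fun a b hab T hT T' hT' => ?_⟩
  obtain ⟨l, hl, ε, hε⟩ := hJ.inner_unit_unit a b hab
  have hderiv := (hJ.hasFDerivAt_inner hT' hl
    (hasDerivAt_exp_smul_apply T q 0).hasFDerivAt).hasDerivAt
  simp only [fun t : ℝ => momentCoord_eq_iff.1 (hinv _ (hS.exp_smul_mem hT t)) l hl T' hT']
    at hderiv
  have hzero : inner ℝ (J l (T' q)) (T q) = (0 : ℝ) := by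
    simpa using hderiv.unique (hasDerivAt_const _ _)
  rw [hε, real_inner_comm, hzero, mul_zero]

variable {q : V} (hq : IsRegularPoint 𝔥 J q)

include hq

/-- The derivative is injective on the span of the vectors `J l (T q)`, `l = 1, 2, 3`, whose
dimension is that of the target. -/
theorem surjective_momentDeriv : Function.Surjective (momentDeriv 𝔥 J q) := by
  let param : (Fin 3 → Fin (Module.finrank ℝ 𝔥) → ℝ) →ₗ[ℝ] Fin 4 → 𝔥 :=
    LinearMap.pi (Fin.cons 0 fun l =>
      ((Module.finBasis ℝ 𝔥).equivFun.symm : _ →ₗ[ℝ] 𝔥) ∘ₗ LinearMap.proj l)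
  have hinj : Function.Injective
      ((momentDeriv 𝔥 J q).toLinearMap ∘ₗ orbitSum 𝔥 J q ∘ₗ param) := by
    refine (injective_iff_map_eq_zero _).2 fun w hw => funext fun l => ?_
    have hzero := momentDeriv_eq_zero_iff.1 hw _ l.succ_ne_zero _ (param w l.succ).2
    rw [LinearMap.comp_apply, inner_unit_orbitSum hJ hq, sq_eq_zero_iff, norm_eq_zero] at hzero
    exact (Module.finBasis ℝ 𝔥).equivFun.symm.map_eq_zero_iff.1
      (Subtype.ext (hq.eq_zero_of_apply_eq_zero _ (param w l.succ).2 hzero))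
  exact Function.Surjective.of_comp (g := orbitSum 𝔥 J q ∘ₗ param)
    (LinearMap.surjective_of_injective hinj)

theorem exists_isTangentSlice {n : ℕ} (hn : n + 4 * Module.finrank ℝ 𝔥 = Module.finrank ℝ V) :
    ∃ H : 𝔼 n →L[ℝ] V, IsTangentSlice 𝔥 (momentDeriv 𝔥 J q) q H := by
  let K := LinearMap.range (orbitSum 𝔥 J q)
  have hfinrank : Module.finrank ℝ Kᗮ = n := by
    have hK : Module.finrank ℝ K = 4 * Module.finrank ℝ 𝔥 := finrank_range_orbitSum hJ hq
    have hadd := K.finrank_add_finrank_orthogonal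
    omega
  let L : 𝔼 n ≃ₗ[ℝ] Kᗮ :=
    LinearEquiv.ofFinrankEq _ _ (by rw [hfinrank, finrank_euclideanSpace_fin])
  let H : 𝔼 n →L[ℝ] V := LinearMap.toContinuousLinearMap (Kᗮ.subtype ∘ₗ L.toLinearMap)
  have horth (v) (hv : v ∈ Kᗮ) (l) (T : V →L[ℝ] V) (hT : T ∈ 𝔥) :
      inner ℝ (J l (T q)) v = (0 : ℝ) :=
    (Submodule.mem_orthogonal _ _).1 hv _ (unit_apply_mem_range_orbitSum l hT)
  have hunit₀ (v) : J 0 v = v := by rw [hJ.unit_zero, one_apply_eq_self]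
  refine ⟨H, fun T hT => momentDeriv_eq_zero_iff.2 fun l hl T' hT' => ?_,
    fun x => momentDeriv_eq_zero_iff.2 fun l _ T hT => horth _ (L x).2 l T hT,
    fun v hv => ?_, fun T hT x hx => ?_⟩
  · simpa only [hunit₀] using hq.inner_unit_apply l 0 hl T' hT' T hT
  · obtain ⟨_, ⟨T, rfl⟩, b, hb, rfl⟩ := K.exists_add_mem_mem_orthogonal v
    have hT (l) (hl : l ≠ 0) : (T l : V →L[ℝ] V) q = 0 := by
      have hzero := momentDeriv_eq_zero_iff.1 hv l hl _ (T l).2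
      rwa [inner_add_right, horth b hb l _ (T l).2, add_zero, inner_unit_orbitSum hJ hq,
        sq_eq_zero_iff, norm_eq_zero] at hzero
    refine ⟨T 0, (T 0).2, L.symm ⟨b, hb⟩, congrArg₂ _ ?_ ?_⟩
    · rw [orbitSum_apply, Finset.sum_eq_single 0 (fun l _ hl => by rw [hT l hl, map_zero])
        (by simp), hunit₀]
    · exact (congrArg Subtype.val (L.apply_symm_apply ⟨b, hb⟩)).symm
  · have hTq : T q = 0 := by
      have hself := horth _ (L x).2 0 T hT
      rwa [hunit₀, show ((L x : Kᗮ) : V) = -T q from eq_neg_of_add_eq_zero_right hx,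
        inner_neg_right, neg_eq_zero, inner_self_eq_zero] at hself
    rw [hTq, zero_add] at hx
    exact ⟨hq.eq_zero_of_apply_eq_zero T hT hTq, L.map_eq_zero_iff.1 (Subtype.ext hx)⟩

theorem exists_isLevelSlice_momentCoord {S : Submonoid (V →L[ℝ] V)} (hS : IsIsometryGroup S 𝔥)
    (hinv : ∀ T ∈ S, ∀ q', momentCoord 𝔥 J q' = momentCoord 𝔥 J q →
      momentCoord 𝔥 J (T q') = momentCoord 𝔥 J q)
    (hfree : ∀ T ∈ S, T q = q → T = 1) {n : ℕ}
    (hn : n + 4 * Module.finrank ℝ 𝔥 = Module.finrank ℝ V) :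
    ∃ (U : Set 𝔼 n) (s : 𝔼 n → V), 0 ∈ U ∧ s 0 = q ∧
      IsLevelSlice S 𝔥 (momentCoord 𝔥 J) (momentCoord 𝔥 J q) U s := by
  obtain ⟨H, hH⟩ := hJ.exists_isTangentSlice hq hn
  exact exists_isLevelSlice hS (contDiff_momentCoord 𝔥 J) hinv hfree
    (hJ.hasFDerivAt_momentCoord q) (hJ.surjective_momentDeriv hq) hH

end IsQuaternionic

end MomentMap

/-! ## Quaternionic matrices and scalars as operators -/

section Operators

theorem isTopologicalRing_clm (V : Type*) [NormedAddCommGroup V] [NormedSpace ℝ V] :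
    IsTopologicalRing (V →L[ℝ] V) := inferInstance

instance (d : ℕ) : IsTopologicalRing (HSpace d →L[ℝ] HSpace d) := isTopologicalRing_clm _

theorem map_exp_clm {𝔸 V : Type*} [NormedRing 𝔸] [NormedAlgebra ℝ 𝔸] [CompleteSpace 𝔸]
    [NormedAddCommGroup V] [NormedSpace ℝ V] (f : 𝔸 →ₐ[ℝ] V →L[ℝ] V) (hf : Continuous f) (a : 𝔸) :
    f (NormedSpace.exp a) = NormedSpace.exp (f a) :=
  let _ : NormedAlgebra ℚ 𝔸 := NormedAlgebra.restrictScalars ℚ ℝ 𝔸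
  let _ : NormedAlgebra ℚ (V →L[ℝ] V) := NormedAlgebra.restrictScalars ℚ ℝ _
  NormedSpace.map_exp f hf a

theorem mem_of_forall_exp_smul_mem {V : Type*} [NormedAddCommGroup V] [NormedSpace ℝ V]
    [FiniteDimensional ℝ V] {W : Submodule ℝ (V →L[ℝ] V)} {X : V →L[ℝ] V}
    (hX : ∀ t : ℝ, NormedSpace.exp (t • X) ∈ W) : X ∈ W :=
  have : CompleteSpace V := FiniteDimensional.complete ℝ V
  mem_of_hasDerivAt W.closed_of_finiteDimensional (hasDerivAt_exp_smul_zero X) hX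

theorem re_mul_comm (a b : ℍ[ℝ]) : (a * b).re = (b * a).re := by
  simp only [Quaternion.re_mul]
  ring

theorem re_sum {ι : Type*} (s : Finset ι) (f : ι → ℍ[ℝ]) : (∑ i ∈ s, f i).re = ∑ i ∈ s, (f i).re :=
  map_sum (QuaternionAlgebra.reₗ (-1 : ℝ) 0 (-1)) f s

/-- The units `1, i, j, k`. -/
def quatUnit : Fin 4 → ℍ[ℝ] := Matrix.vecCons 1 imUnit

theorem quatUnit_succ (l : Fin 3) : quatUnit l.succ = imUnit l := rfl

theorem re_quatUnit (l : Fin 4) : (quatUnit l).re = (![1, 0, 0, 0] : Fin 4 → ℝ) l := by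
  fin_cases l <;> rfl

theorem imI_quatUnit (l : Fin 4) : (quatUnit l).imI = (![0, 1, 0, 0] : Fin 4 → ℝ) l := by
  fin_cases l <;> rfl

theorem imJ_quatUnit (l : Fin 4) : (quatUnit l).imJ = (![0, 0, 1, 0] : Fin 4 → ℝ) l := by
  fin_cases l <;> rfl

theorem imK_quatUnit (l : Fin 4) : (quatUnit l).imK = (![0, 0, 0, 1] : Fin 4 → ℝ) l := by
  fin_cases l <;> rfl

theorem quatUnit_mul_star_self (l : Fin 4) : quatUnit l * star (quatUnit l) = 1 := by
  fin_cases l <;> ext <;> simp [re_quatUnit, imI_quatUnit, imJ_quatUnit, imK_quatUnit]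

theorem star_quatUnit {l : Fin 4} (hl : l ≠ 0) : star (quatUnit l) = -quatUnit l := by
  obtain ⟨l, rfl⟩ := Fin.exists_succ_eq.2 hl
  fin_cases l <;> ext <;> simp [re_quatUnit, imI_quatUnit, imJ_quatUnit, imK_quatUnit]

/-- Up to sign, the units multiply like the bit vectors `00, 01, 10, 11` under `xor`. -/
theorem quatUnit_mul_star (a b : Fin 4) :
    quatUnit b * star (quatUnit a) =
      (quatUnit b * star (quatUnit a) * star (quatUnit (a ^^^ b))).re • quatUnit (a ^^^ b) := by
  fin_cases a <;> fin_cases b <;> ext <;>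
    simp [re_quatUnit, imI_quatUnit, imJ_quatUnit, imK_quatUnit]

theorem xor_ne_zero {a b : Fin 4} (hab : a ≠ b) : a ^^^ b ≠ 0 := by
  revert a b; decide

variable {d : ℕ}

theorem mulVec_apply (A : HMat d) (q : HSpace d) (a : Fin d) :
    mulVec A q a = ∑ b, A a b * q b := rfl

/-- Left multiplication by quaternionic matrices, as a homomorphism to the algebra of real-linear
operators on `ℍ^d`. -/
def leftMul (d : ℕ) : HMat d →ₐ[ℝ] (HSpace d →L[ℝ] HSpace d) :=
  AlgHom.ofLinearMap
    { toFun := fun A => LinearMap.toContinuousLinearMap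
        { toFun := mulVec A
          map_add' := fun v w => congrArg (WithLp.toLp 2) (A.mulVec_add v.ofLp w.ofLp)
          map_smul' := fun r v => congrArg (WithLp.toLp 2) (A.mulVec_smul r v.ofLp) }
      map_add' := fun A B => ContinuousLinearMap.ext fun q =>
        congrArg (WithLp.toLp 2) (A.add_mulVec B q.ofLp)
      map_smul' := fun r A => ContinuousLinearMap.ext fun q =>
        congrArg (WithLp.toLp 2) (A.smul_mulVec r q.ofLp) }
    (ContinuousLinearMap.ext fun q => congrArg (WithLp.toLp 2) (Matrix.one_mulVec q.ofLp))
    (fun A B => ContinuousLinearMap.ext fun q =>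
      congrArg (WithLp.toLp 2) (Matrix.mulVec_mulVec q.ofLp A B).symm)

theorem leftMul_apply (A : HMat d) (q : HSpace d) : leftMul d A q = mulVec A q := rfl

theorem leftMul_injective : Function.Injective (leftMul d) := by
  refine (injective_iff_map_eq_zero _).2 fun A hA => ?_
  ext1 a b
  have hcol := congrArg (fun v : HSpace d => v a)
    (DFunLike.congr_fun hA (WithLp.toLp 2 (Pi.single b 1)))
  simpa [leftMul_apply, mulVec] using hcol

theorem isClosedEmbedding_leftMul : Topology.IsClosedEmbedding (leftMul d) :=
  LinearMap.isClosedEmbedding_of_injective (f := (leftMul d).toLinearMap)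
    (LinearMap.ker_eq_bot.2 leftMul_injective)

section

attribute [local instance] Matrix.linftyOpNormedRing Matrix.linftyOpNormedAlgebra

theorem leftMul_exp (A : HMat d) :
    leftMul d (NormedSpace.exp A) = NormedSpace.exp (leftMul d A) :=
  map_exp_clm (leftMul d) isClosedEmbedding_leftMul.continuous A

end

theorem inner_mulVec (A : HMat d) (v w : HSpace d) :
    inner ℝ (mulVec A v) w = inner ℝ v (mulVec (star A) w) := by
  simp only [PiLp.inner_apply, Quaternion.inner_def, mulVec_apply, Finset.sum_mul, star_sum,
    Finset.mul_sum, re_sum, star_mul, Matrix.star_apply, star_star]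
  rw [Finset.sum_comm]
  refine Finset.sum_congr rfl fun b _ => Finset.sum_congr rfl fun a _ => ?_
  rw [mul_assoc, re_mul_comm, mul_assoc]

theorem norm_mulVec (g : Sp d) (v : HSpace d) : ‖mulVec (g : HMat d) v‖ = ‖v‖ := by
  have hunitary : mulVec (star (g : HMat d)) (mulVec (g : HMat d) v) = v := by
    rw [← leftMul_apply, ← leftMul_apply, ← mul_apply_eq_comp, ← map_mul,
      (Unitary.mem_iff.1 g.2).1, map_one, one_apply_eq_self]
  rw [← sq_eq_sq₀ (norm_nonneg _) (norm_nonneg _), ← real_inner_self_eq_norm_sq,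
    ← real_inner_self_eq_norm_sq, inner_mulVec, hunitary]

/-- Right multiplication by a quaternion, a real-linear operator on `ℍ^d`. -/
def rightMul (d : ℕ) (u : ℍ[ℝ]) : HSpace d →L[ℝ] HSpace d :=
  LinearMap.toContinuousLinearMap
    { toFun := fun v => WithLp.toLp 2 fun a => v a * u
      map_add' := fun v w => PiLp.ext fun a => add_mul (v a) (w a) u
      map_smul' := fun r v => PiLp.ext fun a => smul_mul_assoc r (v a) u }

theorem rightMul_apply (u : ℍ[ℝ]) (v : HSpace d) (a : Fin d) : rightMul d u v a = v a * u := rfl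

theorem inner_rightMul_rightMul (u w : ℍ[ℝ]) (x y : HSpace d) :
    inner ℝ (rightMul d u x) (rightMul d w y) = inner ℝ x (rightMul d (w * star u) y) := by
  simp only [PiLp.inner_apply, Quaternion.inner_def, rightMul_apply, star_mul, star_star, mul_assoc]

theorem rightMul_mulVec (u : ℍ[ℝ]) (A : HMat d) (v : HSpace d) :
    rightMul d u (mulVec A v) = mulVec A (rightMul d u v) := by
  ext1 a
  simp only [rightMul_apply, mulVec_apply, Finset.sum_mul, mul_assoc]

theorem rightMul_one : rightMul d 1 = 1 :=
  ContinuousLinearMap.ext fun v => PiLp.ext fun a => mul_one (v a)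

theorem rightMul_smul (r : ℝ) (u : ℍ[ℝ]) (v : HSpace d) :
    rightMul d (r • u) v = r • rightMul d u v :=
  PiLp.ext fun a => mul_smul_comm r (v a) u

end Operators

/-! ## Closed subgroups of `Sp(d)` as groups of operators -/

section OperatorGroup

variable {d : ℕ}

/-- Right multiplication by the units `1, i, j, k`, the hyperkähler structure of `ℍ^d`. -/
def unitMul (d : ℕ) (l : Fin 4) : HSpace d →L[ℝ] HSpace d := rightMul d (quatUnit l)

/-- A subgroup `G` of `Sp(d)`, as a set of operators on `ℍ^d`. -/
def operatorGroup (G : Subgroup (Sp d)) : Submonoid (HSpace d →L[ℝ] HSpace d) :=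
  G.toSubmonoid.map ((leftMul d : HMat d →* _).comp (unitary (HMat d)).subtype)

theorem mem_operatorGroup {G : Subgroup (Sp d)} {T : HSpace d →L[ℝ] HSpace d} :
    T ∈ operatorGroup G ↔ ∃ g ∈ G, leftMul d (g : HMat d) = T := Iff.rfl

variable (G : Subgroup (Sp d)) (hG : IsClosed (G : Set (Sp d)))

/-- The Lie algebra of `G`, as a space of operators on `ℍ^d`. -/
def operatorLie : Submodule ℝ (HSpace d →L[ℝ] HSpace d) :=
  (lieAlg G hG).map (leftMul d).toLinearMap

variable {G hG}

theorem leftMul_mem_operatorLie {A : HMat d} (hA : A ∈ lieAlg G hG) :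
    leftMul d A ∈ operatorLie G hG := ⟨A, hA, rfl⟩

theorem finrank_operatorLie :
    Module.finrank ℝ (operatorLie G hG) = Module.finrank ℝ (lieAlg G hG) :=
  (Submodule.equivMapOfInjective _ leftMul_injective _).finrank_eq.symm

theorem mem_orbitTangent {q v : HSpace d} :
    v ∈ orbitTangent G hG q ↔ ∃ T ∈ operatorLie G hG, T q = v := by
  constructor
  · rintro ⟨A, hA, rfl⟩
    exact ⟨_, leftMul_mem_operatorLie hA, rfl⟩
  · rintro ⟨_, ⟨A, hA, rfl⟩, rfl⟩
    exact ⟨A, hA, rfl⟩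

theorem isGenerator_iff {A : HMat d} :
    IsGenerator G A ↔ ∀ t : ℝ, NormedSpace.exp (t • leftMul d A) ∈ operatorGroup G := by
  refine forall_congr' fun t => ?_
  rw [← map_smul, ← leftMul_exp, mem_operatorGroup]
  simp only [leftMul_injective.eq_iff]

theorem mem_operatorLie_iff {X : HSpace d →L[ℝ] HSpace d} :
    X ∈ operatorLie G hG ↔ ∀ t : ℝ, NormedSpace.exp (t • X) ∈ operatorGroup G := by
  constructor
  · rintro ⟨A, hA, rfl⟩
    exact isGenerator_iff.1 hA
  · intro hX
    have hrange : X ∈ (leftMul d).toLinearMap.range :=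
      mem_of_forall_exp_smul_mem fun t => by
        obtain ⟨g, -, hg⟩ := mem_operatorGroup.1 (hX t)
        exact ⟨g, hg⟩
    obtain ⟨A, rfl⟩ := hrange
    exact leftMul_mem_operatorLie (isGenerator_iff.2 hX)

theorem isClosed_operatorGroup (hG : IsClosed (G : Set (Sp d))) :
    IsClosed (operatorGroup G : Set (HSpace d →L[ℝ] HSpace d)) := by
  have himage : (operatorGroup G : Set (HSpace d →L[ℝ] HSpace d)) =
      leftMul d '' (Subtype.val '' (G : Set (Sp d))) := by
    rw [Set.image_image]
    rfl
  rw [himage]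
  exact isClosedEmbedding_leftMul.isClosedMap _ (isClosed_coe_image G hG)

theorem isIsometryGroup_operatorGroup :
    IsIsometryGroup (operatorGroup G) (operatorLie G hG) where
  isClosed := isClosed_operatorGroup hG
  inv_mem := by
    rintro _ ⟨g, hg, rfl⟩ T hT
    refine ⟨g⁻¹, G.inv_mem hg, left_inv_eq_right_inv ?_ hT⟩
    rw [← map_mul, inv_mul_cancel, map_one]
  mem_lie_iff _ := mem_operatorLie_iff
  norm_apply := by
    rintro _ ⟨g, -, rfl⟩ v
    exact norm_mulVec g v

theorem isQuaternionic_operatorLie : IsQuaternionic (operatorLie G hG) (unitMul d) where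
  inner_apply_left _ hT := isIsometryGroup_operatorGroup.inner_apply_left hT
  mul_sub_mul_mem _ hT _ hT' := isIsometryGroup_operatorGroup.mul_sub_mul_mem_lie hT hT'
  unit_zero := rightMul_one
  unit_comm := by
    rintro _ ⟨A, -, rfl⟩ l v
    exact rightMul_mulVec _ A v
  norm_unit l v := by
    rw [← sq_eq_sq₀ (norm_nonneg _) (norm_nonneg _), ← real_inner_self_eq_norm_sq,
      ← real_inner_self_eq_norm_sq, unitMul, inner_rightMul_rightMul, quatUnit_mul_star_self,
      rightMul_one, one_apply_eq_self]
  inner_unit_left l hl v w := by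
    have hadjoint := inner_rightMul_rightMul (quatUnit l) 1 v w
    rwa [rightMul_one, one_apply_eq_self, one_mul, star_quatUnit hl, ← neg_one_smul ℝ,
      rightMul_smul, real_inner_smul_right, neg_one_mul] at hadjoint
  inner_unit_unit a b hab := by
    refine ⟨a ^^^ b, xor_ne_zero hab,
      (quatUnit b * star (quatUnit a) * star (quatUnit (a ^^^ b))).re, fun v w => ?_⟩
    rw [unitMul, unitMul, unitMul, inner_rightMul_rightMul, ← real_inner_smul_right,
      ← rightMul_smul, ← quatUnit_mul_star]

end OperatorGroup

/-! ## Level sets of the moment map -/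

section LevelSet

variable {d : ℕ} {G : Subgroup (Sp d)} {hG : IsClosed (G : Set (Sp d))} {c : Fin 3 → HMat d}

theorem inner_matEuclid_spMoment (l : Fin 3) (q : HSpace d) (A : HMat d) :
    inner ℝ (matEuclid d (spMoment l q)) (matEuclid d A) =
      inner ℝ (leftMul d A q) (unitMul d l.succ q) := by
  have hentry : ∀ (B : HMat d) p, matEuclid d B p = B p.1 p.2 := fun _ _ => rfl
  simp only [PiLp.inner_apply, Quaternion.inner_def, leftMul_apply, mulVec_apply, unitMul,
    rightMul_apply, quatUnit_succ, hentry, spMoment, Matrix.of_apply, Finset.sum_mul, re_sum,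
    Fintype.sum_prod_type]
  refine Finset.sum_congr rfl fun a _ => Finset.sum_congr rfl fun b _ => ?_
  rw [← Quaternion.re_star]
  simp only [star_mul, star_star, mul_assoc]

theorem starProjection_eq_starProjection_iff {𝕜 E : Type*} [RCLike 𝕜] [NormedAddCommGroup E]
    [InnerProductSpace 𝕜 E] {W : Submodule 𝕜 E} [W.HasOrthogonalProjection] {v v' : E} :
    W.starProjection v = W.starProjection v' ↔ ∀ w ∈ W, inner 𝕜 v w = inner 𝕜 v' w := by
  rw [← sub_eq_zero, ← map_sub, Submodule.starProjection_apply_eq_zero_iff,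
    Submodule.mem_orthogonal']
  simp only [inner_sub_left, sub_eq_zero]

theorem momentMap_eq_momentMap_iff {l : Fin 3} {q q' : HSpace d} :
    momentMap G hG l q = momentMap G hG l q' ↔ ∀ T ∈ operatorLie G hG,
      inner ℝ (T q) (unitMul d l.succ q) = inner ℝ (T q') (unitMul d l.succ q') := by
  rw [momentMap, momentMap, (matEuclid d).symm.injective.eq_iff,
    starProjection_eq_starProjection_iff, operatorLie]
  simp only [Submodule.mem_map, forall_exists_index, and_imp, forall_apply_eq_imp_iff₂,
    LinearEquiv.coe_coe, AlgHom.toLinearMap_apply, inner_matEuclid_spMoment]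

theorem mem_levelSet_iff {q₀ : HSpace d} (hq₀ : q₀ ∈ levelSet G hG c) {q : HSpace d} :
    q ∈ levelSet G hG c ↔ momentCoord (operatorLie G hG) (unitMul d) q =
      momentCoord (operatorLie G hG) (unitMul d) q₀ := by
  rw [momentCoord_eq_iff, Fin.forall_fin_succ]
  simp only [ne_eq, not_true_eq_false, false_imp_iff, true_and, Fin.succ_ne_zero, not_false_eq_true,
    true_imp_iff, ← momentMap_eq_momentMap_iff]
  exact forall_congr' fun l => by rw [hq₀ l]

theorem zero_mem_levelSet : (0 : HSpace d) ∈ levelSet G hG 0 := fun l => by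
  have hzero : spMoment l (0 : HSpace d) = 0 := by
    ext1 a b
    simp [spMoment]
  simp [momentMap, hzero]

theorem isClosed_levelSet : IsClosed (levelSet G hG c) := by
  rcases (levelSet G hG c).eq_empty_or_nonempty with hempty | ⟨q₀, hq₀⟩
  · exact hempty ▸ isClosed_empty
  · have hfiber : levelSet G hG c = {q | momentCoord (operatorLie G hG) (unitMul d) q =
        momentCoord (operatorLie G hG) (unitMul d) q₀} := Set.ext fun _ => mem_levelSet_iff hq₀
    rw [hfiber]
    exact isClosed_eq (contDiff_momentCoord _ _).continuous continuous_const

theorem isCompact_levelSet_norm_le (R : ℝ) :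
    IsCompact {q : levelSet G hG c | ‖(q : HSpace d)‖ ≤ R} := by
  have : ProperSpace (HSpace d) := FiniteDimensional.proper ℝ _
  have hball := isClosed_levelSet.isClosedEmbedding_subtypeVal.isCompact_preimage
    (isCompact_closedBall (0 : HSpace d) R) (X := levelSet G hG c)
  simpa only [Set.preimage, mem_closedBall_zero_iff] using hball

end LevelSet

section Stabilizer

variable {d : ℕ} {G : Subgroup (Sp d)} {hG : IsClosed (G : Set (Sp d))}

/-- The one-parameter group generated by `A` is a path in the stabilizer, hence constant. -/
theorem eq_zero_of_discreteTopology_stabilizer {q : HSpace d}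
    [DiscreteTopology (MulAction.stabilizer G q)] {T : HSpace d →L[ℝ] HSpace d}
    (hT : T ∈ operatorLie G hG) (hTq : T q = 0) : T = 0 := by
  have : CompleteSpace (HSpace d) := FiniteDimensional.complete ℝ _
  refine eq_zero_of_forall_exp_smul_eq_one (𝔸 := HSpace d →L[ℝ] HSpace d) fun t => ?_
  choose g hg hexp using mem_operatorLie_iff.1 hT
  have hfix : ∀ t, (⟨g t, hg t⟩ : G) ∈ MulAction.stabilizer G q := fun t => by
    change leftMul d (g t : HMat d) q = q
    exact (congrArg (· q) (hexp t)).trans (exp_smul_apply_eq_self hTq t)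
  have hcont : Continuous fun t => (g t : HMat d) :=
    isClosedEmbedding_leftMul.isInducing.continuous_iff.2
      ((continuous_exp_smul T).congr fun t => (hexp t).symm)
  have hpath : Continuous fun t => (⟨⟨g t, hg t⟩, hfix t⟩ : MulAction.stabilizer G q) :=
    ((hcont.subtype_mk _).subtype_mk _).subtype_mk _
  have hconst := PreconnectedSpace.constant inferInstance hpath (x := t) (y := 0)
  have hgt : g t = g 0 := congrArg (fun z : MulAction.stabilizer G q => ((z : G) : Sp d)) hconst
  rw [← hexp t, hgt, hexp 0]
  exact (congrArg _ (zero_smul ℝ T)).trans NormedSpace.exp_zero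

end Stabilizer

/-! ## Charts of the quotient -/

section Quotient

variable {d : ℕ} {G : Subgroup (Sp d)} {hG : IsClosed (G : Set (Sp d))} {c : Fin 3 → HMat d}

theorem proj_eq_proj_iff {q q' : levelSet G hG c} :
    proj G hG c q = proj G hG c q' ↔ ∃ T ∈ operatorGroup G, T (q' : HSpace d) = q := by
  have horbit : proj G hG c q = proj G hG c q' ↔ ∃ g : G, g • (q' : HSpace d) = q :=
    Quotient.eq (r := orbitSetoid G hG c)
  rw [horbit]
  constructor
  · rintro ⟨g, hg⟩
    exact ⟨_, ⟨g, g.2, rfl⟩, hg⟩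
  · rintro ⟨_, ⟨g, hg, rfl⟩, h⟩
    exact ⟨⟨g, hg⟩, h⟩

theorem continuous_proj : Continuous (proj G hG c) := continuous_quotient_mk'

theorem proj_surjective : Function.Surjective (proj G hG c) := Quotient.mk_surjective

theorem isOpen_iff_preimage_proj {W : Set (QuotSpace G hG c)} :
    IsOpen W ↔ IsOpen (proj G hG c ⁻¹' W) := Iff.rfl

theorem finrank_HSpace (d : ℕ) : Module.finrank ℝ (HSpace d) = 4 * d := by
  rw [(WithLp.linearEquiv 2 ℝ (Fin d → ℍ[ℝ])).finrank_eq, Module.finrank_pi_fintype]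
  simp [Quaternion.finrank_eq_four, mul_comm]

theorem quotDim_add {q : HSpace d} (hq : IsRegularPoint (operatorLie G hG) (unitMul d) q) :
    quotDim G hG + 4 * Module.finrank ℝ (operatorLie G hG) = Module.finrank ℝ (HSpace d) := by
  have hle := Submodule.finrank_le (orbitSum (operatorLie G hG) (unitMul d) q).range
  rw [finrank_range_orbitSum isQuaternionic_operatorLie hq, finrank_HSpace,
    finrank_operatorLie] at hle
  rw [finrank_HSpace, finrank_operatorLie, quotDim]
  omega

theorem IsLevelSlice.mem_levelSet {q₀ : HSpace d} (hq₀ : q₀ ∈ levelSet G hG c) {n : ℕ}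
    {U : Set 𝔼 n} {s : 𝔼 n → HSpace d}
    (hs : IsLevelSlice (operatorGroup G) (operatorLie G hG)
      (momentCoord (operatorLie G hG) (unitMul d))
      (momentCoord (operatorLie G hG) (unitMul d) q₀) U s) {x : 𝔼 n} (hx : x ∈ U) :
    s x ∈ levelSet G hG c :=
  (mem_levelSet_iff hq₀).2 (hs.map_eq x hx)

variable (hfree : ActsFreelyOn G (levelSet G hG c))

include hfree

namespace ActsFreelyOn

theorem apply_mem_levelSet {q : HSpace d} (hq : q ∈ levelSet G hG c)
    {T : HSpace d →L[ℝ] HSpace d} (hT : T ∈ operatorGroup G) : T q ∈ levelSet G hG c := by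
  obtain ⟨g, hg, rfl⟩ := hT
  exact hfree.1 g hg q hq

theorem eq_one_of_apply_eq_self {q : HSpace d} (hq : q ∈ levelSet G hG c)
    {T : HSpace d →L[ℝ] HSpace d} (hT : T ∈ operatorGroup G) (hTq : T q = q) : T = 1 := by
  obtain ⟨g, hg, rfl⟩ := hT
  have hstab : (⟨g, hg⟩ : G) ∈ MulAction.stabilizer G q := MulAction.mem_stabilizer_iff.2 hTq
  rw [hfree.2 q hq, Subgroup.mem_bot] at hstab
  obtain rfl : g = 1 := congrArg Subtype.val hstab
  exact map_one (leftMul d)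

theorem isRegularPoint {q : HSpace d} (hq : q ∈ levelSet G hG c) :
    IsRegularPoint (operatorLie G hG) (unitMul d) q := by
  have : CompleteSpace (HSpace d) := FiniteDimensional.complete ℝ _
  refine isQuaternionic_operatorLie.isRegularPoint isIsometryGroup_operatorGroup.toIsClosedGroup
    (fun T hT => (mem_levelSet_iff hq).1 (hfree.apply_mem_levelSet hq hT)) fun T hT hTq => ?_
  exact eq_zero_of_forall_exp_smul_eq_one (𝔸 := HSpace d →L[ℝ] HSpace d) fun t =>
    hfree.eq_one_of_apply_eq_self hq (isIsometryGroup_operatorGroup.exp_smul_mem hT t)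
      (exp_smul_apply_eq_self hTq t)

theorem exists_isLevelSlice {q : HSpace d} (hq : q ∈ levelSet G hG c) :
    ∃ (U : Set 𝔼(quotDim G hG)) (s : 𝔼(quotDim G hG) → HSpace d), 0 ∈ U ∧ s 0 = q ∧
      IsLevelSlice (operatorGroup G) (operatorLie G hG)
        (momentCoord (operatorLie G hG) (unitMul d))
        (momentCoord (operatorLie G hG) (unitMul d) q) U s :=
  isQuaternionic_operatorLie.exists_isLevelSlice_momentCoord (hfree.isRegularPoint hq)
    isIsometryGroup_operatorGroup
    (fun _ hT _ hq' =>
      (mem_levelSet_iff hq).1 (hfree.apply_mem_levelSet ((mem_levelSet_iff hq).2 hq') hT))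
    (fun _ hT hTq => hfree.eq_one_of_apply_eq_self hq hT hTq)
    (quotDim_add (hfree.isRegularPoint hq))

end ActsFreelyOn

namespace IsLevelSlice

variable {q₀ : HSpace d} (hq₀ : q₀ ∈ levelSet G hG c) {n : ℕ} {U : Set 𝔼 n} {s : 𝔼 n → HSpace d}
  (hs : IsLevelSlice (operatorGroup G) (operatorLie G hG)
    (momentCoord (operatorLie G hG) (unitMul d))
    (momentCoord (operatorLie G hG) (unitMul d) q₀) U s)

include hq₀ hs

theorem isOpenMap_proj : IsOpenMap fun x : U => proj G hG c ⟨s x, hs.mem_levelSet hq₀ x.2⟩ := by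
  intro W hW
  rw [isOpen_iff_preimage_proj, isOpen_iff_mem_nhds]
  rintro q ⟨x, hxW, hx⟩
  obtain ⟨T, hT, hTq⟩ := proj_eq_proj_iff.1 hx
  have hTmem : ∀ z : levelSet G hG c, T z ∈ levelSet G hG c := fun z =>
    hfree.apply_mem_levelSet z.2 hT
  have hnear : ∀ᶠ z : levelSet G hG c in 𝓝 q, ∃ T' ∈ operatorGroup G,
      ∃ y ∈ Subtype.val '' W, T z = T' (s y) := by
    have hcont : Tendsto (fun z : levelSet G hG c => T z) (𝓝 q) (𝓝 (s x)) :=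
      (T.continuous.comp continuous_subtype_val).tendsto' _ _ hTq
    have hnhds := (hs.isOpen.isOpenMap_subtype_val _ hW).mem_nhds ⟨x, hxW, rfl⟩
    filter_upwards [hcont.eventually (hs.eventually_mem_orbit x x.2 _ hnhds)] with z hz
    exact hz ((mem_levelSet_iff hq₀).1 (hTmem z))
  filter_upwards [hnear] with z hz
  obtain ⟨T', hT', _, ⟨y, hyW, rfl⟩, hy⟩ := hz
  have hz : proj G hG c ⟨T z, hTmem z⟩ = proj G hG c z := proj_eq_proj_iff.2 ⟨T, hT, rfl⟩
  exact ⟨y, hyW, (proj_eq_proj_iff.2 ⟨T', hT', hy.symm⟩).symm.trans hz⟩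

theorem isOpenEmbedding_proj :
    Topology.IsOpenEmbedding fun x : U => proj G hG c ⟨s x, hs.mem_levelSet hq₀ x.2⟩ := by
  refine .of_continuous_injective_isOpenMap ?_ ?_ (hs.isOpenMap_proj hfree hq₀)
  · exact continuous_proj.comp (hs.contDiffOn.continuousOn.domRestrict.subtype_mk _)
  · intro x y hxy
    obtain ⟨T, hT, hTs⟩ := proj_eq_proj_iff.1 hxy
    exact Subtype.ext (hs.eq_of_mem_orbit y y.2 x x.2 T hT hTs).symm

end IsLevelSlice

theorem exists_chart (p : QuotSpace G hG c) :
    ∃ φ : Chart G hG c, ∃ x : φ.source, φ.point x = p := by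
  obtain ⟨⟨q, hq⟩, rfl⟩ := proj_surjective p
  obtain ⟨U, s, h0, hs0, hs⟩ := hfree.exists_isLevelSlice hq
  let φ : Chart G hG c :=
    { source := U
      isOpen_source := hs.isOpen
      slice := s
      contDiffOn_slice := hs.contDiffOn
      slice_mem := fun _ hx => hs.mem_levelSet hq hx
      transverse := fun x hx u hu => by
        obtain ⟨T, hT, hTs⟩ := mem_orbitTangent.1 hu
        exact hs.transverse x hx u T hT hTs.symm
      isOpenEmbedding := hs.isOpenEmbedding_proj hfree hq }
  exact ⟨φ, ⟨0, h0⟩, congrArg (proj G hG c) (Subtype.ext hs0)⟩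

end Quotient

/-! ## The curvature of the quotient -/

section Curvature

variable {d : ℕ} {G : Subgroup (Sp d)} {hG : IsClosed (G : Set (Sp d))} {c : Fin 3 → HMat d}
  (hfree : ActsFreelyOn G (levelSet G hG c))

namespace Chart

variable (φ : Chart G hG c)

theorem inner_fderiv_unitMul {x : 𝔼(quotDim G hG)} (hx : x ∈ φ.source) (u : 𝔼(quotDim G hG))
    {l : Fin 4} (hl : l ≠ 0) {T : HSpace d →L[ℝ] HSpace d} (hT : T ∈ operatorLie G hG) :
    inner ℝ (fderiv ℝ φ.slice x u) (unitMul d l (T (φ.slice x))) = 0 := by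
  have hs : HasFDerivAt φ.slice (fderiv ℝ φ.slice x) x :=
    ((φ.contDiffOn_slice.contDiffAt (φ.isOpen_source.mem_nhds hx)).differentiableAt
      (by simp)).hasFDerivAt
  have hconst : (fun y => inner ℝ (T (φ.slice y)) (unitMul d l (φ.slice y))) =ᶠ[𝓝 x]
      fun _ => inner ℝ (T (φ.slice x)) (unitMul d l (φ.slice x)) := by
    filter_upwards [φ.isOpen_source.mem_nhds hx] with y hy
    exact momentCoord_eq_iff.1
      ((mem_levelSet_iff (φ.slice_mem x hx)).1 (φ.slice_mem y hy)) l hl T hT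
  have hderiv := (isQuaternionic_operatorLie.hasFDerivAt_inner hT hl hs).unique
    ((hasFDerivAt_const _ x).congr_of_eventuallyEq hconst)
  rw [real_inner_comm]
  simpa using DFunLike.congr_fun hderiv u

include hfree

theorem isSlice (hne : φ.source.Nonempty) :
    IsSlice (operatorLie G hG) (unitMul d) φ.source φ.slice where
  isOpen := φ.isOpen_source
  contDiffOn := φ.contDiffOn_slice
  isRegularPoint x hx := hfree.isRegularPoint (φ.slice_mem x hx)
  inner_fderiv_unit _ hx u _ hl _ hT := φ.inner_fderiv_unitMul hx u hl hT
  transverse x hx u T hT h := φ.transverse x hx u (mem_orbitTangent.2 ⟨T, hT, h.symm⟩)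
  finrank_eq := hne.elim fun x hx => quotDim_add (hfree.isRegularPoint (φ.slice_mem x hx))

theorem starProjection_fderiv {x : 𝔼(quotDim G hG)} (hx : x ∈ φ.source)
    (u : 𝔼(quotDim G hG)) :
    (orbitTangent G hG (φ.slice x))ᗮ.starProjection (fderiv ℝ φ.slice x u) =
      horizontalFrame (operatorLie G hG) φ.slice x u := by
  refine Submodule.eq_starProjection_of_mem_orthogonal ?_ ?_
  · rw [Submodule.mem_orthogonal']
    intro v hv
    obtain ⟨T, hT, rfl⟩ := mem_orbitTangent.1 hv
    exact (φ.isSlice hfree ⟨x, hx⟩).inner_horizontalFrame_apply hx isQuaternionic_operatorLie u hT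
  · refine Submodule.le_orthogonal_orthogonal _ (mem_orbitTangent.2 ⟨_,
      conn_mem φ.slice x u, ?_⟩)
    rw [horizontalFrame_apply, covDeriv]
    abel

theorem metric_eq {x : 𝔼(quotDim G hG)} (hx : x ∈ φ.source) (i j : Fin (quotDim G hG)) :
    φ.metric x i j =
      inner ℝ (horizontalFrame (operatorLie G hG) φ.slice x (EuclideanSpace.single i 1))
        (horizontalFrame (operatorLie G hG) φ.slice x (EuclideanSpace.single j 1)) := by
  rw [metric, Matrix.of_apply, φ.starProjection_fderiv hfree hx, φ.starProjection_fderiv hfree hx]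

theorem abs_sectionalCurvature_le {x u v : 𝔼(quotDim G hG)} (hx : x ∈ φ.source) {δ : ℝ}
    (hδ : 0 < δ) (hbound : ∀ T ∈ operatorLie G hG, δ * ‖T‖ ≤ ‖T (φ.slice x)‖)
    (huv : LinearIndependent ℝ ![u, v]) :
    |sectionalCurvature φ.metric x u v| ≤ 40 / δ ^ 2 :=
  (φ.isSlice hfree ⟨x, hx⟩).abs_sectionalCurvature_le isQuaternionic_operatorLie hx
    (fun _ hy i j => φ.metric_eq hfree hy i j) hδ hbound huv

end Chart

theorem exists_mul_norm_le_norm_apply_of_mem_levelSet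
    (hlf : ActsLocallyFreelyOn G (levelSet G hG 0 \ {0})) :
    ∃ δ > 0, ∃ R > 0, ∀ q ∈ levelSet G hG c, R ≤ ‖q‖ → ∀ T ∈ operatorLie G hG,
      δ * ‖q‖ * ‖T‖ ≤ ‖T q‖ := by
  rcases (levelSet G hG c).eq_empty_or_nonempty with hempty | ⟨q₀, hq₀⟩
  · exact ⟨1, one_pos, 1, one_pos, fun q hq => absurd hq (hempty ▸ Set.notMem_empty q)⟩
  have hinj : ∀ q, q ≠ 0 → momentCoord (operatorLie G hG) (unitMul d) q = 0 →
      ∀ T ∈ operatorLie G hG, T q = 0 → T = 0 := fun q hq0 hq T hT hTq => by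
    have hmem : q ∈ levelSet G hG 0 := by
      rw [mem_levelSet_iff zero_mem_levelSet, hq, momentCoord_zero]
    have := hlf q ⟨hmem, hq0⟩
    exact eq_zero_of_discreteTopology_stabilizer hT hTq
  obtain ⟨δ, hδ, R, hR, hbound⟩ := exists_mul_norm_le_norm_apply hinj
    (momentCoord (operatorLie G hG) (unitMul d) q₀)
  exact ⟨δ, hδ, R, hR, fun q hq => hbound q ((mem_levelSet_iff hq₀).1 hq)⟩

include hfree

theorem asymptoticallyNullCurvature (hlf : ActsLocallyFreelyOn G (levelSet G hG 0 \ {0})) :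
    AsymptoticallyNullCurvature G hG c := by
  intro ε hε
  obtain ⟨δ, hδ, R, hR, hbound⟩ := exists_mul_norm_le_norm_apply_of_mem_levelSet (c := c) hlf
  have hdecay : Tendsto (fun r : ℝ => 40 / (δ * r) ^ 2) atTop (𝓝 0) :=
    ((tendsto_pow_atTop two_ne_zero).comp (tendsto_id.const_mul_atTop hδ)).const_div_atTop 40
  obtain ⟨R', hR'⟩ := eventually_atTop.1 (hdecay.eventually_lt_const hε)
  refine ⟨_, (isCompact_levelSet_norm_le (max R R')).image continuous_proj, ?_⟩
  rintro p hp K ⟨φ, x, u, v, rfl, huv, rfl⟩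
  have hmem := φ.slice_mem x x.2
  have hfar : max R R' < ‖φ.slice x‖ := by
    by_contra hle
    exact hp ⟨⟨φ.slice x, hmem⟩, not_lt.1 hle, rfl⟩
  obtain ⟨hRx, hRx'⟩ := max_lt_iff.1 hfar
  have hcurv := φ.abs_sectionalCurvature_le hfree x.2 (mul_pos hδ (hR.trans hRx))
    (hbound _ hmem hRx.le) huv
  exact hcurv.trans_lt (hR' _ hRx'.le)

end Curvature

end HKQuot

end

theorem mainTheorem5 (d : ℕ) (G : Subgroup (HKQuot.Sp d)) (hG : IsClosed (G : Set (HKQuot.Sp d)))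
    (hlf : HKQuot.ActsLocallyFreelyOn G (HKQuot.levelSet G hG 0 \ {0}))
    (c : Fin 3 → HKQuot.HMat d) (hc : ∀ l, HKQuot.IsCentral G hG (c l))
    (hfree : HKQuot.ActsFreelyOn G (HKQuot.levelSet G hG c)) :
    (∀ p : HKQuot.QuotSpace G hG c, ∃ φ : HKQuot.Chart G hG c, ∃ x : φ.source, φ.point x = p) ∧
      HKQuot.AsymptoticallyNullCurvature G hG c :=
  ⟨HKQuot.exists_chart hfree, HKQuot.asymptoticallyNullCurvature hfree hlf⟩
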